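/- Let $\mathcal X,\mathcal Y$ be finite sets, $P$ a probability mass function (pmf) on $\mathcal X$, $W(\cdot|\cdot)$ a discrete memoryless channel from $\mathcal X$ to $\mathcal Y$, $q:\mathcal X\times\mathcal Y\to\mathbb R$ a single-letter decoding metric, and $R>0$. Logarithms are natural, $|t|_+=\max\{t,0\}$, and a minimum over the empty set is $+\infty$. For pmfs write $q(V_{XY})=\mathbb E_V[q(X,Y)]$, and for $d:\mathcal X\times\mathcal X\to\mathbb R$ write $d(V_{X\tilde X})=\mathbb E_V[d(X,\tilde X)]$. Let $\mathcal V$ be the set of pmfs $V_{X\tilde XY}$ on $\mathcal X\times\mathcal X\times\mathcal Y$ with $V_X=V_{\tilde X}=P$ and $q(V_{\tilde XY})\ge q(V_{XY})$. For $\Delta\in\mathbb R$ let $$E_{\rm RGV}(R,d,\Delta)=\min_{V\in\mathcal V:\ d(V_{X\tilde X})\ge\Delta}D(V_{Y|X}\|W|P)+|I_V(\tilde X;Y,X)-R|_+ ,$$ and say that $(R,\Delta)$ satisfies the rate condition for $d$ with slack $\delta>0$ if $$R\le\min_{P_{X\tilde X}:\ P_X=P_{\tilde X}=P,\ d(P_{X\tilde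 X})\le\Delta}I(X;\tilde X)-2\delta .$$ For $s\ge0$ let $$d_s(x,x')=-\log\sum_yW(y|x)\Big(\frac{e^{q(x',y)}}{e^{q(x,y)}}\Big)^s$$ be the Chernoff distance, and for $d:\mathcal X\times\mathcal X\to\mathbb R$, $\rho'\ge0$, $a:\mathcal X\to\mathbb R$ put $$S_d(\rho',a)=\sum_xP(x)\log\sum_{x'}P(x')e^{-\frac{d(x,x')}{1+\rho'}}\frac{e^{a(x')}}{e^{a(x)}} .$$ The mismatched random-coding exponent in primal and dual form is $$E_{\rm r}=\min_{V\in\mathcal V}D(V_{Y|X}\|W|P)+|I_V(\tilde X;Y)-R|_+,$$ $$E_{\rm r}'=\sup_{\rho\in[0,1],\,s\ge0,\,a(\cdot)}-\sum_xP(x)\log\sum_yW(y|x)\Big(\frac{\sum_{x'}P(x')e^{sq(x',y)}e^{a(x')}}{e^{sq(x,y)}e^{a(x)}}\Big)^\rho-\rho R,$$ and the mismatched expurgated exponent in primal and dual form is $$E_{\rm ex}=\min_{V\in\mathcal V:\ I_V(X;\tilde X)\le R}D(V_{Y|X\tilde X}\|W|V_{X\tilde X})+I_V(X;\tilde X)-R,$$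 $$E_{\rm ex}'=\sup_{\rho'\ge0,\,s\ge0,\,a(\cdot)}-(1+\rho')S_{d_s}(\rho',a)-(1+\rho')R .$$ Here, in $E_{\rm ex}$, $W$ denotes the channel $(x,\tilde x)\mapsto W(\cdot|x)$. Then the following hold. 1. For every $s>0$ and every $\Delta\in\mathbb R$, $E_{\rm RGV}(R,d_s,\Delta)\ge\max\{E_{\rm r},E_{\rm r}'\}$; and if $\Delta<d_s(x,x')$ for all $x,x'$, then the rate condition for $d_s$ holds for every slack $\delta>0$. 2. Let $s>0$, $\rho'\ge0$, $a:\mathcal X\to\mathbb R$, $\delta>0$ and $\Delta=-(1+\rho')\big(S_{d_s}(\rho',a)+R+2\delta\big)$. Then the objective of the dual form of the RGV exponent, $$-\sum_xP(x)\log\sum_yW(y|x)\Big(\frac{\sum_{x'}P(x')e^{sq(x',y)}e^{a(x')}e^{r(d_s(x,x')-\Delta)}}{e^{sq(x,y)}e^{a(x)}}\Big)^\rho-\rho R,$$ equals $-(1+\rho')S_{d_s}(\rho',a)-(1+\rho')R-2\delta\rho'$ at $\rho=1$, $r=\frac{\rho'}{1+\rho'}$; the objective of the dual form of the rate condition, $$-\sum_xP(x)\log\sum_{x'}P(x')e^{a(x')-\mathbb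 E_P[a(X)]}e^{-r(d_s(x,x')-\Delta)}-2\delta,$$ equals $R$ at $r=\frac1{1+\rho'}$; the rate condition for $d_s$ with slack $\delta$ holds; and $$E_{\rm RGV}(R,d_s,\Delta)\ge-(1+\rho')S_{d_s}(\rho',a)-(1+\rho')R-2\delta\rho' .$$ 3. For every real $E<\max\{E_{\rm r},E_{\rm r}',E_{\rm ex},E_{\rm ex}'\}$ there are $s>0$ and $\delta_0>0$ such that for every $\delta\in(0,\delta_0)$ there is a $\Delta\in\mathbb R$ for which the rate condition for $d_s$ holds with slack $\delta$ and $E_{\rm RGV}(R,d_s,\Delta)\ge E$. 4. (ML decoding.) If $W(y|x)>0$ and $q(x,y)=\log W(y|x)$ for all $x,y$, then $d_{1/2}$ equals the Bhattacharyya distance $d_{\rm B}(x,x')=-\log\sum_y\sqrt{W(y|x)W(y|x')}$, which is symmetric, and the assertion of item 3 holds with $s=\frac12$ for every such $E$. -/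

import Mathlib

open scoped BigOperators

noncomputable section

namespace RGV

/-! A probability mass function on a finite set `A` is a function `V : A → ℝ` with
`V ∈ stdSimplex ℝ A`. Random variables on `A` are functions on `A`. All logarithms are natural. -/

open Classical in
/-- The law (pushforward) of the random variable `f` under the pmf `V`. -/
def law {A B : Type*} [Fintype A] (V : A → ℝ) (f : A → B) : B → ℝ :=
  fun b => ∑ a, if f a = b then V a else 0

/-- The mutual information `I_V(f; g)` of two finite-valued random variables, in nats.
A summand with joint probability `0` contributes `0`. -/
def mutualInfo {A B C : Type*} [Fintype A] [Fintype B] [Fintype C]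
    (V : A → ℝ) (f : A → B) (g : A → C) : ℝ :=
  ∑ b, ∑ c, law V (fun a => (f a, g a)) (b, c) *
    Real.log (law V (fun a => (f a, g a)) (b, c) / (law V f b * law V g c))

/-- The conditional probability `V_{g|f}(c|b)` (only used where `V_f(b) > 0`). -/
def condPmf {A B C : Type*} [Fintype A] (V : A → ℝ) (f : A → B) (g : A → C) (b : B) (c : C) : ℝ :=
  law V (fun a => (f a, g a)) (b, c) / law V f b

open Classical in
/-- The conditional divergence `D(V_{g|f} ‖ W | P) = ∑_b P(b) D(V_{g|f}(·|b) ‖ W(·|b))`;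
it is `+∞` as soon as absolute continuity fails at some `b` with `P(b) ≠ 0`. -/
def condDiv {A B C : Type*} [Fintype A] [Fintype B] [Fintype C]
    (V : A → ℝ) (f : A → B) (g : A → C) (W : B → C → ℝ) (P : B → ℝ) : EReal :=
  if ∀ b c, P b ≠ 0 → condPmf V f g b c ≠ 0 → W b c ≠ 0 then
    ((∑ b, P b * ∑ c, condPmf V f g b c * Real.log (condPmf V f g b c / W b c) : ℝ) : EReal)
  else ⊤

/-- Additive extension of a single-letter function to pmfs: `E_Q[h(A, B)]`. -/
def additive {A B : Type*} [Fintype A] [Fintype B] (h : A → B → ℝ) (Q : A × B → ℝ) : ℝ :=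
  ∑ a, ∑ b, Q (a, b) * h a b

variable {X Y : Type*}

/-! Coordinates of a triple `(x, x̃, y)`. -/

/-- The random variable `X`. -/
def cX (v : X × X × Y) : X := v.1
/-- The random variable `X̃`. -/
def cX' (v : X × X × Y) : X := v.2.1
/-- The random variable `Y`. -/
def cY (v : X × X × Y) : Y := v.2.2
/-- The pair `(X, X̃)`. -/
def cXX' (v : X × X × Y) : X × X := (v.1, v.2.1)
/-- The pair `(X, Y)`. -/
def cXY (v : X × X × Y) : X × Y := (v.1, v.2.2)
/-- The pair `(X̃, Y)`. -/
def cX'Y (v : X × X × Y) : X × Y := (v.2.1, v.2.2)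

variable [Fintype X] [Fintype Y]

/-- Joint pmfs `V_{X X̃ Y}` with `V_X = V_X̃ = P` and `q(V_{X̃Y}) ≥ q(V_{XY})`,
for a type-dependent metric `q`. -/
def metricSet (P : X → ℝ) (q : (X × Y → ℝ) → ℝ) : Set (X × X × Y → ℝ) :=
  {V | V ∈ stdSimplex ℝ (X × X × Y) ∧ law V cX = P ∧ law V cX' = P ∧
    q (law V cXY) ≤ q (law V cX'Y)}

/-- The constraint set `T_{d,q,P}(Δ)` of the RGV exponent. -/
def rgvSet (P : X → ℝ) (q : (X × Y → ℝ) → ℝ) (d : (X × X → ℝ) → ℝ) (Δ : ℝ) :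
    Set (X × X × Y → ℝ) :=
  {V | V ∈ metricSet P q ∧ Δ ≤ d (law V cXX')}

/-- The RGV exponent
`min_{V ∈ T_{d,q,P}(Δ)} D(V_{Y|X} ‖ W | P) + |I(X̃; Y, X) - R|₊` (`+∞` on an empty set). -/
def rgvExponent (R : ℝ) (P : X → ℝ) (W : X → Y → ℝ) (q : (X × Y → ℝ) → ℝ)
    (d : (X × X → ℝ) → ℝ) (Δ : ℝ) : EReal :=
  ⨅ V ∈ rgvSet P q d Δ,
    condDiv V cX cY W P + ((max (mutualInfo V cX' cXY - R) 0 : ℝ) : EReal)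

/-- The rate condition
`R ≤ min {I(X; X̃) : P_X = P_X̃ = P, d(P_{X X̃}) ≤ Δ} - 2δ` (the minimum over `∅` is `+∞`). -/
def RateCondition (R : ℝ) (P : X → ℝ) (d : (X × X → ℝ) → ℝ) (Δ δ : ℝ) : Prop :=
  (R : EReal) ≤
    (⨅ Q ∈ {Q : X × X → ℝ | Q ∈ stdSimplex ℝ (X × X) ∧
        law Q Prod.fst = P ∧ law Q Prod.snd = P ∧ d Q ≤ Δ},
      (mutualInfo Q Prod.fst Prod.snd : EReal)) - ((2 * δ : ℝ) : EReal)

/-- The mismatched random-coding exponent (primal form)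
`min D(V_{Y|X} ‖ W | P) + |I(X̃; Y) - R|₊` over `V_X = V_X̃ = P`, `q(V_{X̃Y}) ≥ q(V_{XY})`. -/
def rcExponent (R : ℝ) (P : X → ℝ) (W : X → Y → ℝ) (q : (X × Y → ℝ) → ℝ) : EReal :=
  ⨅ V ∈ metricSet P q,
    condDiv V cX cY W P + ((max (mutualInfo V cX' cY - R) 0 : ℝ) : EReal)

/-- The mismatched expurgated exponent (primal form)
`min D(V_{Y|X X̃} ‖ W | V_{X X̃}) + I(X; X̃) - R`
over `V_X = V_X̃ = P`, `q(V_{X̃Y}) ≥ q(V_{XY})`, `I(X; X̃) ≤ R`. -/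
def exExponent (R : ℝ) (P : X → ℝ) (W : X → Y → ℝ) (q : (X × Y → ℝ) → ℝ) : EReal :=
  ⨅ V ∈ {V : X × X × Y → ℝ | V ∈ metricSet P q ∧ mutualInfo V cX cX' ≤ R},
    condDiv V cXX' cY (fun p => W p.1) (law V cXX') + ((mutualInfo V cX cX' - R : ℝ) : EReal)

/-- The Chernoff distance `d_s(x,x') = -log ∑_y W(y|x) (e^{q(x',y)} / e^{q(x,y)})^s`. -/
def chernoff (W : X → Y → ℝ) (q : X → Y → ℝ) (s : ℝ) (x x' : X) : ℝ :=
  -Real.log (∑ y, W x y * (Real.exp (q x' y) / Real.exp (q x y)) ^ s)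

/-- The Bhattacharyya distance `d_B(x,x') = -log ∑_y √(W(y|x) W(y|x'))`. -/
def bhattacharyya (W : X → Y → ℝ) (x x' : X) : ℝ :=
  -Real.log (∑ y, Real.sqrt (W x y * W x' y))

/-- The objective of the dual form of the RGV exponent for additive `q` and `d`. -/
def rgvDualObjective (R : ℝ) (P : X → ℝ) (W : X → Y → ℝ) (q : X → Y → ℝ) (d : X → X → ℝ)
    (Δ ρ r s : ℝ) (a : X → ℝ) : ℝ :=
  -(∑ x, P x * Real.log (∑ y, W x y *
      ((∑ x', P x' * Real.exp (s * q x' y) * Real.exp (a x') * Real.exp (r * (d x x' - Δ))) /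
        (Real.exp (s * q x y) * Real.exp (a x))) ^ ρ)) - ρ * R

/-- The objective of the dual form of the rate condition, with `φ_a = E_P[a(X)]`
(the condition reads `R ≤ sup_{r ≥ 0, a} (this) - 2δ`). -/
def rateDualObjective (P : X → ℝ) (d : X → X → ℝ) (Δ r : ℝ) (a : X → ℝ) : ℝ :=
  -(∑ x, P x * Real.log (∑ x', P x' * Real.exp (a x' - ∑ z, P z * a z) *
      Real.exp (-r * (d x x' - Δ))))

/-- The mismatched random-coding exponent (dual form): the supremum over
`ρ ∈ [0,1]`, `s ≥ 0` and `a : X → ℝ`. -/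
def rcDual (R : ℝ) (P : X → ℝ) (W : X → Y → ℝ) (q : X → Y → ℝ) : EReal :=
  ⨆ (ρ : ℝ) (_ : 0 ≤ ρ ∧ ρ ≤ 1) (s : ℝ) (_ : 0 ≤ s) (a : X → ℝ),
    ((-(∑ x, P x * Real.log (∑ y, W x y *
      ((∑ x', P x' * Real.exp (s * q x' y) * Real.exp (a x')) /
        (Real.exp (s * q x y) * Real.exp (a x))) ^ ρ)) - ρ * R : ℝ) : EReal)

/-- `∑_x P(x) log ∑_{x'} P(x') e^{-d(x,x')/(1+ρ')} e^{a(x')} / e^{a(x)}`. -/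
def exSum (P : X → ℝ) (d : X → X → ℝ) (ρ' : ℝ) (a : X → ℝ) : ℝ :=
  ∑ x, P x * Real.log (∑ x', P x' * Real.exp (-(d x x') / (1 + ρ')) *
    (Real.exp (a x') / Real.exp (a x)))

/-- The objective of the dual form of the expurgated exponent. -/
def exDualObjective (R : ℝ) (P : X → ℝ) (d : X → X → ℝ) (ρ' : ℝ) (a : X → ℝ) : ℝ :=
  -(1 + ρ') * exSum P d ρ' a - (1 + ρ') * R

/-- The mismatched expurgated exponent (dual form): the supremum over
`ρ' ≥ 0`, `s ≥ 0` and `a : X → ℝ`. -/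
def exDual (R : ℝ) (P : X → ℝ) (W : X → Y → ℝ) (q : X → Y → ℝ) : EReal :=
  ⨆ (ρ' : ℝ) (_ : 0 ≤ ρ') (s : ℝ) (_ : 0 ≤ s) (a : X → ℝ),
    ((exDualObjective R P (chernoff W q s) ρ' a : ℝ) : EReal)

/-- The threshold
`Δ = -(1+ρ') (∑_x P(x) log ∑_{x'} P(x') e^{-d(x,x')/(1+ρ')} e^{a(x')}/e^{a(x)} + R + 2δ)`. -/
def exThreshold (R : ℝ) (P : X → ℝ) (d : X → X → ℝ) (ρ' : ℝ) (a : X → ℝ) (δ : ℝ) : ℝ :=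
  -(1 + ρ') * (exSum P d ρ' a + R + 2 * δ)

/-- With the additive distance of single-letter function `d`, the RGV exponent attains the level
`E` at rate `R`: for all sufficiently small slack `δ > 0` there is a threshold `Δ` that obeys the
rate condition and for which the RGV exponent is at least `E`. -/
def Attains (R : ℝ) (P : X → ℝ) (W : X → Y → ℝ) (q : X → Y → ℝ) (d : X → X → ℝ)
    (E : ℝ) : Prop :=
  ∃ δ₀ : ℝ, 0 < δ₀ ∧ ∀ δ : ℝ, 0 < δ → δ < δ₀ → ∃ Δ : ℝ,
    RateCondition R P (additive d) Δ δ ∧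
    (E : EReal) ≤ rgvExponent R P W (additive q) (additive d) Δ

end RGV

end

/-! Everything below the expurgated exponents goes through one inequality
(`SatisfiesLagrangeBound`): E ≤ d(Q) + (1+ρ)(I(Q) - R) for all couplings Q of P with itself. With Δ
= E - 2δ(1+ρ), a coupling with d(Q) ≤ Δ must have I ≥ R + 2δ, which is the rate condition. For the
exponent, `chernoff_add_mutualInfo_le` bounds the RGV objective below by d_s + I(X;X̃) - R, and this
is at least E - 2δρ: by the Lagrange bound if I - R ≤ 2δ, and by d_s ≥ Δ otherwise.

The bound has two sources. The dual objective satisfies it by nonnegativity of the divergence from a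
Gibbs coupling. For the primal exponent, `exists_lagrange_multiplier` is applied twice: the
multiplier of the metric constraint is the Chernoff parameter s, and the multiplier of I(X;X̃) ≤ R
is ρ. If s = 0, the level is negative and the dual random-coding exponent covers it.

The random-coding exponents lie below the RGV exponent for every Δ, by data processing (primal) and
weak duality (dual); a Δ below all distances makes the rate condition vacuous.

For ML decoding, averaging a coupling with its swap does not increase I and symmetrizes d_s, and the
symmetrized Chernoff distance is at most the Bhattacharyya distance. So the Lagrange bound passes
from any s to s = 1/2. -/

noncomputable section

namespace RGV

/-! ### Laws of random variables; information and divergence as expectations. -/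

section Law

variable {A B C : Type*} [Fintype A] [Fintype B] [Fintype C]

theorem sum_law_mul (V : A → ℝ) (f : A → B) (h : B → ℝ) :
    ∑ b, law V f b * h b = ∑ a, V a * h (f a) := by
  classical
  simp only [law, Finset.sum_mul]
  rw [Finset.sum_comm]
  refine Finset.sum_congr rfl fun a _ => ?_
  simp [ite_mul]

theorem sum_law (V : A → ℝ) (f : A → B) : ∑ b, law V f b = ∑ a, V a := by
  simpa using sum_law_mul V f (fun _ => 1)

omit [Fintype C] in
theorem law_law (V : A → ℝ) (f : A → B) (g : B → C) :
    law (law V f) g = law V (fun a => g (f a)) := by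
  classical
  funext c
  have := sum_law_mul V f (fun b => if g b = c then 1 else 0)
  simpa [law] using this

omit [Fintype B] in
theorem law_nonneg {V : A → ℝ} (hV : ∀ a, 0 ≤ V a) (f : A → B) (b : B) : 0 ≤ law V f b :=
  Finset.sum_nonneg fun a _ => by split_ifs <;> simp [hV a]

omit [Fintype B] in
theorem le_law {V : A → ℝ} (hV : ∀ a, 0 ≤ V a) (f : A → B) (a : A) : V a ≤ law V f (f a) := by
  classical
  have := Finset.single_le_sum (f := fun a' => if f a' = f a then V a' else 0)
    (fun a' _ => by split_ifs <;> simp [hV a']) (Finset.mem_univ a)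
  simpa [law] using this

omit [Fintype B] in
theorem law_pos {V : A → ℝ} (hV : ∀ a, 0 ≤ V a) (f : A → B) {a : A} (ha : V a ≠ 0) :
    0 < law V f (f a) :=
  ((hV a).lt_of_ne' ha).trans_le (le_law hV f a)

omit [Fintype B] in
theorem law_of_injective (V : A → ℝ) {f : A → B} (hf : Function.Injective f) (a : A) :
    law V f (f a) = V a := by
  classical
  simp [law, hf.eq_iff]

omit [Fintype B] in
theorem exists_of_law_ne_zero {V : A → ℝ} {f : A → B} {b : B} (h : law V f b ≠ 0) :
    ∃ a, f a = b ∧ V a ≠ 0 := by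
  classical
  obtain ⟨a, -, ha⟩ := Finset.exists_ne_zero_of_sum_ne_zero h
  by_cases hab : f a = b
  · exact ⟨a, hab, by simpa [hab] using ha⟩
  · simp [hab] at ha

theorem law_mem_stdSimplex {V : A → ℝ} (hV : V ∈ stdSimplex ℝ A) (f : A → B) :
    law V f ∈ stdSimplex ℝ B :=
  ⟨law_nonneg hV.1 f, by rw [sum_law, hV.2]⟩

omit [Fintype B] in
theorem law_add_smul (V V' : A → ℝ) (f : A → B) (s t : ℝ) :
    law (s • V + t • V') f = s • law V f + t • law V' f := by
  classical
  funext b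
  simp only [law, Pi.add_apply, Pi.smul_apply, smul_eq_mul, Finset.mul_sum,
    ← Finset.sum_add_distrib]
  refine Finset.sum_congr rfl fun a _ => ?_
  split_ifs <;> simp

omit [Fintype B] in
theorem continuous_law (f : A → B) : Continuous fun V : A → ℝ => law V f := by
  classical
  refine continuous_pi fun b => continuous_finsetSum _ fun a _ => ?_
  split_ifs <;> fun_prop

theorem mutualInfo_eq_sum (V : A → ℝ) (f : A → B) (g : A → C) :
    mutualInfo V f g = ∑ a, V a * Real.log (law V (fun a => (f a, g a)) (f a, g a) /
      (law V f (f a) * law V g (g a))) := by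
  rw [← sum_law_mul V (fun a => (f a, g a))
    (fun p => Real.log (law V (fun a => (f a, g a)) p / (law V f p.1 * law V g p.2))),
    Fintype.sum_prod_type]
  rfl

theorem additive_law (V : A → ℝ) (f : A → B × C) (h : B → C → ℝ) :
    additive h (law V f) = ∑ a, V a * h (f a).1 (f a).2 := by
  rw [← sum_law_mul V f (fun p => h p.1 p.2), Fintype.sum_prod_type]
  rfl

omit [Fintype B] [Fintype C] in
theorem law_eq_zero_of_law_prod {V : A → ℝ} (hV : ∀ a, 0 ≤ V a) (f : A → B) (g : A → C)
    {b : B} {c : C} (h : law V f b = 0) : law V (fun a => (f a, g a)) (b, c) = 0 := by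
  by_contra hne
  obtain ⟨a, ha, hva⟩ := exists_of_law_ne_zero hne
  have := law_pos hV f hva
  simp only [Prod.mk.injEq] at ha
  rw [ha.1, h] at this
  exact this.false

omit [Fintype B] [Fintype C] in
theorem absCont_iff {V : A → ℝ} (hV : ∀ a, 0 ≤ V a) (f : A → B) (g : A → C) (W : B → C → ℝ) :
    (∀ b c, law V f b ≠ 0 → condPmf V f g b c ≠ 0 → W b c ≠ 0) ↔
      ∀ a, V a ≠ 0 → W (f a) (g a) ≠ 0 := by
  constructor
  · intro h a ha
    exact h _ _ (law_pos hV f ha).ne'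
      (div_ne_zero (law_pos hV (fun a => (f a, g a)) ha).ne' (law_pos hV f ha).ne')
  · intro h b c _ hc
    obtain ⟨a, ha, hva⟩ := exists_of_law_ne_zero (div_ne_zero_iff.1 hc).1
    simp only [Prod.mk.injEq] at ha
    simpa [ha.1, ha.2] using h a hva

/-- The conditional divergence as an expectation. -/
theorem condDiv_eq_sum {V : A → ℝ} (hV : ∀ a, 0 ≤ V a) (f : A → B) (g : A → C) (W : B → C → ℝ)
    (h : ∀ a, V a ≠ 0 → W (f a) (g a) ≠ 0) :
    condDiv V f g W (law V f) = ((∑ a, V a * Real.log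
      (law V (fun a => (f a, g a)) (f a, g a) / law V f (f a) / W (f a) (g a)) : ℝ) : EReal) := by
  rw [condDiv, if_pos ((absCont_iff hV f g W).2 h), ← sum_law_mul V (fun a => (f a, g a))
    (fun p => Real.log (law V (fun a => (f a, g a)) p / law V f p.1 / W p.1 p.2)),
    Fintype.sum_prod_type]
  congr 1
  refine Finset.sum_congr rfl fun b _ => ?_
  rw [Finset.mul_sum]
  refine Finset.sum_congr rfl fun c _ => ?_
  rw [← mul_assoc, condPmf]
  by_cases hb : law V f b = 0
  · simp [hb, law_eq_zero_of_law_prod hV f g hb]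
  · rw [mul_div_cancel₀ _ hb]

theorem condDiv_eq_top {V : A → ℝ} (hV : ∀ a, 0 ≤ V a) (f : A → B) (g : A → C) (W : B → C → ℝ)
    (h : ¬ ∀ a, V a ≠ 0 → W (f a) (g a) ≠ 0) : condDiv V f g W (law V f) = ⊤ := by
  rw [condDiv, if_neg fun h' => h ((absCont_iff hV f g W).1 h')]

/-- Nonnegativity of the divergence from a subprobability mass function. -/
theorem sum_mul_log_div_nonneg {V N : A → ℝ} (hV : V ∈ stdSimplex ℝ A) (hN : ∀ a, 0 ≤ N a)
    (hN1 : ∑ a, N a ≤ 1) (h : ∀ a, V a ≠ 0 → N a ≠ 0) :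
    0 ≤ ∑ a, V a * Real.log (V a / N a) := by
  have key : ∀ a, V a - N a ≤ V a * Real.log (V a / N a) := by
    intro a
    by_cases ha : V a = 0
    · simp [ha, hN a]
    · have hVa := (hV.1 a).lt_of_ne' ha
      have hNa := (hN a).lt_of_ne' (h a ha)
      have h1 := Real.one_sub_inv_le_log_of_pos (div_pos hVa hNa)
      calc V a - N a = V a * (1 - (V a / N a)⁻¹) := by field_simp
        _ ≤ _ := mul_le_mul_of_nonneg_left h1 hVa.le
  have := Finset.sum_le_sum fun a (_ : a ∈ Finset.univ) => key a
  rw [Finset.sum_sub_distrib, hV.2] at this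
  linarith

end Law

/-! ### Lagrangian duality without a constraint qualification. -/

/-- Lagrange multipliers for a convex programme with one inequality constraint on a compact set;
no constraint qualification is needed, as the bound is only claimed for levels below the value. -/
theorem exists_lagrange_multiplier {E : Type*} [TopologicalSpace E] [AddCommGroup E] [Module ℝ E]
    {K : Set E} (hK : IsCompact K) {f g : E → ℝ} (hf : ConvexOn ℝ K f) (hg : ConvexOn ℝ K g)
    (hfc : ContinuousOn f K) (hgc : ContinuousOn g K) {c : ℝ}
    (h : ∀ x ∈ K, g x ≤ 0 → c < f x) :
    ∃ s : ℝ, 0 ≤ s ∧ ∀ x ∈ K, c ≤ f x + s * g x := by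
  rcases K.eq_empty_or_nonempty with rfl | ⟨x₀, hx₀⟩
  · exact ⟨0, le_rfl, by simp⟩
  let S : Set (ℝ × ℝ) := {p | ∃ x ∈ K, f x ≤ p.1 ∧ g x ≤ p.2}
  let T : Set (ℝ × ℝ) := Set.Iio c ×ˢ Set.Iio 0
  have hS : Convex ℝ S := by
    rintro p ⟨x, hx, hx1, hx2⟩ p' ⟨y, hy, hy1, hy2⟩ a b ha hb hab
    refine ⟨a • x + b • y, hf.1 hx hy ha hb hab, ?_, ?_⟩
    · refine (hf.2 hx hy ha hb hab).trans ?_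
      simp only [smul_eq_mul, Prod.fst_add, Prod.smul_fst]
      gcongr
    · refine (hg.2 hx hy ha hb hab).trans ?_
      simp only [smul_eq_mul, Prod.snd_add, Prod.smul_snd]
      gcongr
  have hT : Convex ℝ T := (convex_Iio c).prod (convex_Iio 0)
  have hTo : IsOpen T := isOpen_Iio.prod isOpen_Iio
  have hdisj : Disjoint T S := by
    rw [Set.disjoint_left]
    rintro p ⟨hp1, hp2⟩ ⟨x, hx, hx1, hx2⟩
    have := h x hx (hx2.trans (le_of_lt hp2))
    have hp1' : p.1 < c := hp1
    linarith
  -- `S` is closed under increasing either coordinate, which forces both coefficients of the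
  -- separating functional to be nonnegative.
  obtain ⟨φ, u, hφT, hφS⟩ := geometric_hahn_banach_open hT hTo hS hdisj
  have hφ : ∀ x y : ℝ, φ (x, y) = x * φ (1, 0) + y * φ (0, 1) := by
    intro x y
    have : (x, y) = x • ((1 : ℝ), (0 : ℝ)) + y • ((0 : ℝ), (1 : ℝ)) := by simp
    rw [this, map_add, map_smul, map_smul, smul_eq_mul, smul_eq_mul]
  set l := φ (1, 0)
  set m := φ (0, 1)
  have hTlt : ∀ x y : ℝ, x < c → y < 0 → x * l + y * m < u := fun x y hx hy => by
    rw [← hφ]; exact hφT _ ⟨hx, hy⟩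
  have hSle : ∀ x ∈ K, ∀ a b : ℝ, 0 ≤ a → 0 ≤ b → u ≤ (f x + a) * l + (g x + b) * m :=
    fun x hx a b ha hb => by
      rw [← hφ]; exact hφS _ ⟨x, hx, by simpa using ha, by simpa using hb⟩
  have hl : 0 ≤ l := by
    by_contra! hl
    -- This `t` brings the functional down to `u + l < u` at a point of `S`.
    set t := (f x₀ * l + g x₀ * m - u) / (-l) + 1
    have h1 := hSle x₀ hx₀ 0 0 le_rfl le_rfl
    have h2 := hSle x₀ hx₀ t 0 (by
      have : 0 ≤ (f x₀ * l + g x₀ * m - u) / (-l) := div_nonneg (by linarith) (by linarith)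
      positivity) le_rfl
    have h3 : t * l = -(f x₀ * l + g x₀ * m - u) + l := by
      simp only [t]; have := hl.ne; field_simp
    nlinarith
  have hm : 0 ≤ m := by
    by_contra! hm
    set t := (f x₀ * l + g x₀ * m - u) / (-m) + 1
    have h1 := hSle x₀ hx₀ 0 0 le_rfl le_rfl
    have h2 := hSle x₀ hx₀ 0 t le_rfl (by
      have : 0 ≤ (f x₀ * l + g x₀ * m - u) / (-m) := div_nonneg (by linarith) (by linarith)
      positivity)
    have h3 : t * m = -(f x₀ * l + g x₀ * m - u) + m := by
      simp only [t]; have := hm.ne; field_simp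
    nlinarith
  -- Points of `T` approach the corner (c, 0).
  have hcl : c * l ≤ u := by
    have hlim : Filter.Tendsto (fun t : ℝ => (c - t) * l + (-t) * m)
        (nhdsWithin 0 (Set.Ioi 0)) (nhds ((c - 0) * l + (-0) * m)) :=
      (Continuous.tendsto (by fun_prop) 0).mono_left nhdsWithin_le_nhds
    have := le_of_tendsto hlim (b := u) (by
      filter_upwards [self_mem_nhdsWithin] with t ht
      have ht' : 0 < t := ht
      exact (hTlt _ _ (by linarith) (by linarith)).le)
    simpa using this
  have hfg : ∀ x ∈ K, c * l ≤ f x * l + g x * m := fun x hx => by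
    simpa using hcl.trans (hSle x hx 0 0 le_rfl le_rfl)
  -- If `l = 0`, the separating line gives no multiplier, only `0 ≤ g` on `K`. On the compact set
  -- where `f ≤ c`, the strict hypothesis makes `g` positive, hence bounded away from 0, so a large
  -- enough multiple of `g` covers the deficit of `f`.
  rcases hl.eq_or_lt with hl0 | hl0
  · have hm0 : 0 < m := by
      refine hm.lt_of_ne fun hm0 => ?_
      have h1 := hTlt (c - 1) (-1) (by linarith) (by linarith)
      have h2 := hSle x₀ hx₀ 0 0 le_rfl le_rfl
      rw [← hl0, ← hm0] at h1 h2
      linarith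
    have hg0 : ∀ x ∈ K, 0 ≤ g x := fun x hx => by
      have := hfg x hx
      rw [← hl0] at this
      simp only [mul_zero, zero_add] at this
      exact nonneg_of_mul_nonneg_left this hm0
    have hK' : IsCompact {x ∈ K | f x ≤ c} := by
      have : IsCompact (K ∩ f ⁻¹' Set.Iic c) := by
        obtain ⟨u, hu, hu'⟩ := continuousOn_iff_isClosed.1 hfc _ (isClosed_Iic (a := c))
        rw [Set.inter_comm, hu', Set.inter_comm]
        exact hK.inter_right hu
      exact this
    rcases Set.eq_empty_or_nonempty {x ∈ K | f x ≤ c} with he | hne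
    · refine ⟨0, le_rfl, fun x hx => ?_⟩
      by_contra! hlt
      exact (Set.eq_empty_iff_forall_notMem.1 he x) ⟨hx, by linarith⟩
    · have hsub : {x ∈ K | f x ≤ c} ⊆ K := fun x hx => hx.1
      obtain ⟨y, hy, hymin⟩ := hK'.exists_isMinOn hne (hgc.mono hsub)
      obtain ⟨z, hz, hzmin⟩ := hK'.exists_isMinOn hne (hfc.mono hsub)
      have hgy : 0 < g y := by
        by_contra! hgy
        exact absurd (h y hy.1 hgy) (not_lt.2 hy.2)
      have hs : 0 ≤ (c - f z) / g y := div_nonneg (sub_nonneg.2 hz.2) hgy.le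
      refine ⟨(c - f z) / g y, hs, fun x hx => ?_⟩
      by_cases hxc : f x ≤ c
      · have h1 : f z ≤ f x := hzmin ⟨hx, hxc⟩
        have h2 : g y ≤ g x := hymin ⟨hx, hxc⟩
        have h3 : (c - f z) / g y * g y = c - f z := div_mul_cancel₀ _ hgy.ne'
        have := mul_le_mul_of_nonneg_left h2 hs
        linarith
      · have := mul_nonneg hs (hg0 x hx)
        push Not at hxc
        linarith
  · refine ⟨m / l, div_nonneg hm hl, fun x hx => ?_⟩
    have h1 := hfg x hx
    have h2 : (f x + m / l * g x) * l = f x * l + g x * m := by field_simp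
    rw [← h2] at h1
    exact le_of_mul_le_mul_right h1 hl0

/-! ### The Chernoff tilt and the lower bound on the RGV objective. -/

variable {X Y : Type*} [Fintype X] [Fintype Y]

theorem sum_triple (F : X × X × Y → ℝ) : ∑ v, F v = ∑ x, ∑ x', ∑ y, F (x, x', y) := by
  simp [Fintype.sum_prod_type]

theorem law_self_apply (V : X × X × Y → ℝ) (v : X × X × Y) :
    law V (fun v => (cX' v, cXY v)) (cX' v, cXY v) = V v :=
  law_of_injective V (fun v w h => by
    simp only [cX', cXY, Prod.mk.injEq] at h
    exact Prod.ext h.2.1 (Prod.ext h.1 h.2.2)) v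

theorem law_self_apply' (V : X × X × Y → ℝ) (v : X × X × Y) :
    law V (fun v => (cXX' v, cY v)) (cXX' v, cY v) = V v :=
  law_of_injective V (fun v w h => by
    simp only [cXX', cY, Prod.mk.injEq] at h
    exact Prod.ext h.1.1 (Prod.ext h.1.2 h.2)) v

/-- A bound on the finite values of the objective of the RGV exponent bounds the objective. -/
theorem le_objective {V : X × X × Y → ℝ} (hV : ∀ v, 0 ≤ V v) {W : X → Y → ℝ}
    {I R E : ℝ} (h : (∀ v, V v ≠ 0 → W v.1 v.2.2 ≠ 0) →
      E ≤ (∑ v, V v * Real.log (law V cXY (cXY v) / law V cX v.1 / W v.1 v.2.2)) + max (I - R) 0) :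
    (E : EReal) ≤ condDiv V cX cY W (law V cX) + ((max (I - R) 0 : ℝ) : EReal) := by
  by_cases hac : ∀ v, V v ≠ 0 → W v.1 v.2.2 ≠ 0
  · rw [condDiv_eq_sum hV cX cY W hac, ← EReal.coe_add]
    exact EReal.coe_le_coe_iff.2 (h hac)
  · rw [condDiv_eq_top hV cX cY W hac, EReal.top_add_coe]
    exact le_top

theorem metric_le {V : X × X × Y → ℝ} {q : X → Y → ℝ}
    (h : additive q (law V cXY) ≤ additive q (law V cX'Y)) :
    ∑ v, V v * q v.1 v.2.2 ≤ ∑ v, V v * q v.2.1 v.2.2 := by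
  rwa [additive_law, additive_law] at h

omit [Fintype X] in
theorem chernoff_sum_pos {W : X → Y → ℝ} (hW : ∀ x, W x ∈ stdSimplex ℝ Y) (q : X → Y → ℝ)
    (s : ℝ) (x x' : X) : 0 < ∑ y, W x y * (Real.exp (q x' y) / Real.exp (q x y)) ^ s := by
  obtain ⟨y, -, hy⟩ := Finset.exists_ne_zero_of_sum_ne_zero (by rw [(hW x).2]; exact one_ne_zero)
  exact Finset.sum_pos' (fun y _ => mul_nonneg ((hW x).1 y) (by positivity))
    ⟨y, Finset.mem_univ _, mul_pos (((hW x).1 y).lt_of_ne' hy) (by positivity)⟩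

theorem exp_div_exp_rpow (a b s : ℝ) : (Real.exp a / Real.exp b) ^ s = Real.exp (s * (a - b)) := by
  rw [← Real.exp_sub, ← Real.exp_mul, mul_comm]

omit [Fintype X] in
theorem exp_neg_chernoff {W : X → Y → ℝ} (hW : ∀ x, W x ∈ stdSimplex ℝ Y) (q : X → Y → ℝ)
    (s : ℝ) (x x' : X) : Real.exp (-chernoff W q s x x') =
      ∑ y, W x y * Real.exp (s * (q x' y - q x y)) := by
  rw [chernoff, neg_neg, Real.exp_log (chernoff_sum_pos hW q s x x')]
  simp only [exp_div_exp_rpow]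

omit [Fintype X] in
theorem sum_tilted {W : X → Y → ℝ} (hW : ∀ x, W x ∈ stdSimplex ℝ Y) (q : X → Y → ℝ)
    (s : ℝ) (x x' : X) :
    ∑ y, W x y * Real.exp (s * (q x' y - q x y) + chernoff W q s x x') = 1 := by
  simp only [Real.exp_add, ← mul_assoc, ← Finset.sum_mul]
  rw [← exp_neg_chernoff hW, ← Real.exp_add]
  simp

/-- `D(V_{Y|X} ‖ W | P) + I(X̃; Y, X) ≥ d_s(V_{XX̃}) + I(X; X̃)` on `metricSet`. -/
theorem chernoff_add_mutualInfo_le {V : X × X × Y → ℝ} (hV : V ∈ stdSimplex ℝ (X × X × Y))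
    {W : X → Y → ℝ} (hW : ∀ x, W x ∈ stdSimplex ℝ Y) {q : X → Y → ℝ} {s : ℝ} (hs : 0 ≤ s)
    (hq : additive q (law V cXY) ≤ additive q (law V cX'Y))
    (hac : ∀ v, V v ≠ 0 → W v.1 v.2.2 ≠ 0) :
    additive (chernoff W q s) (law V cXX') + mutualInfo V cX cX' ≤
      (∑ v, V v * Real.log (law V cXY (cXY v) / law V cX v.1 / W v.1 v.2.2)) +
        mutualInfo V cX' cXY := by
  -- `N` keeps the law of (X, X̃) and tilts W by the metric difference; e^{d_s} is its
  -- normalization. By the chain rule the left-over terms of D(V‖N) ≥ 0 are the claim plus s times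
  -- the metric gap, which has the right sign.
  set N : X × X × Y → ℝ := fun v => law V cXX' (cXX' v) * (W v.1 v.2.2 *
    Real.exp (s * (q v.2.1 v.2.2 - q v.1 v.2.2) + chernoff W q s v.1 v.2.1)) with hN
  have hN1 : ∑ v, N v = 1 := by
    rw [sum_triple]
    simp only [hN, cXX', ← Finset.mul_sum, sum_tilted hW, mul_one]
    rw [← Fintype.sum_prod_type (f := law V cXX'), sum_law, hV.2]
  have key := sum_mul_log_div_nonneg hV (N := N)
    (fun v => mul_nonneg (law_nonneg hV.1 _ _) (mul_nonneg ((hW _).1 _) (Real.exp_pos _).le))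
    hN1.le (fun v hv => mul_ne_zero (law_pos hV.1 cXX' hv).ne'
      (mul_ne_zero (hac v hv) (Real.exp_ne_zero _)))
  have hq' := mul_le_mul_of_nonneg_left (metric_le hq) hs
  rw [additive_law, mutualInfo_eq_sum, mutualInfo_eq_sum, ← Finset.sum_add_distrib,
    ← Finset.sum_add_distrib]
  rw [Finset.mul_sum, Finset.mul_sum] at hq'
  have : ∑ v, V v * Real.log (V v / N v) + ∑ v, s * (V v * q v.2.1 v.2.2) =
      ∑ v, (V v * Real.log (law V cXY (cXY v) / law V cX v.1 / W v.1 v.2.2) +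
        V v * Real.log (law V (fun v => (cX' v, cXY v)) (cX' v, cXY v) /
          (law V cX' (cX' v) * law V cXY (cXY v)))) -
      ∑ v, (V v * chernoff W q s (cXX' v).1 (cXX' v).2 +
        V v * Real.log (law V (fun v => (cX v, cX' v)) (cX v, cX' v) /
          (law V cX (cX v) * law V cX' (cX' v)))) + ∑ v, s * (V v * q v.1 v.2.2) := by
    rw [← Finset.sum_sub_distrib, ← Finset.sum_add_distrib, ← Finset.sum_add_distrib]
    refine Finset.sum_congr rfl fun v _ => ?_
    by_cases hv : V v = 0
    · simp [hv]
    have h1 := (law_pos hV.1 cX hv).ne'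
    have h2 := (law_pos hV.1 cX' hv).ne'
    have h3 := (law_pos hV.1 cXY hv).ne'
    have h4 := (law_pos hV.1 cXX' hv).ne'
    have h5 := hac v hv
    rw [law_self_apply]
    change _ = V v * Real.log (law V cXY (cXY v) / law V cX (cX v) / W v.1 v.2.2) + _ -
      (_ + V v * Real.log (law V cXX' (cXX' v) / _)) + _
    simp only [hN]
    rw [Real.log_div hv (mul_ne_zero h4 (mul_ne_zero h5 (Real.exp_ne_zero _))),
      Real.log_mul h4 (mul_ne_zero h5 (Real.exp_ne_zero _)), Real.log_mul h5 (Real.exp_ne_zero _),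
      Real.log_exp, Real.log_div (div_ne_zero h3 h1) h5, Real.log_div h3 h1,
      Real.log_div hv (mul_ne_zero h2 h3), Real.log_mul h2 h3, Real.log_div h4 (mul_ne_zero h1 h2),
      Real.log_mul h1 h2]
    simp only [cXX']
    ring
  linarith

/-! ### The Lagrange bound and its consequences. -/

/-- Every joint pmf with marginals `P` satisfies `E ≤ d + (1 + ρ)(I - R)`. -/
def SatisfiesLagrangeBound (R : ℝ) (P : X → ℝ) (d : X → X → ℝ) (ρ E : ℝ) : Prop :=
  ∀ Q ∈ stdSimplex ℝ (X × X), law Q Prod.fst = P → law Q Prod.snd = P →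
    E ≤ additive d Q + (1 + ρ) * (mutualInfo Q Prod.fst Prod.snd - R)

theorem RateCondition.of_forall {R : ℝ} {P : X → ℝ} {d : (X × X → ℝ) → ℝ} {Δ δ : ℝ}
    (h : ∀ Q ∈ stdSimplex ℝ (X × X), law Q Prod.fst = P → law Q Prod.snd = P → d Q ≤ Δ →
      R + 2 * δ ≤ mutualInfo Q Prod.fst Prod.snd) : RateCondition R P d Δ δ := by
  rw [RateCondition, EReal.le_sub_iff_add_le (Or.inl (EReal.coe_ne_bot _))
    (Or.inl (EReal.coe_ne_top _)), ← EReal.coe_add]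
  exact le_iInf₂ fun Q hQ => EReal.coe_le_coe_iff.2 (h Q hQ.1 hQ.2.1 hQ.2.2.1 hQ.2.2.2)

/-- The threshold is the level lowered by 2δ(1+ρ), so that d(Q) ≤ Δ leaves (1+ρ)(I - R) ≥ (1+ρ)2δ.
-/
theorem SatisfiesLagrangeBound.rateCondition {R : ℝ} {P : X → ℝ} {d : X → X → ℝ} {ρ E : ℝ}
    (h : SatisfiesLagrangeBound R P d ρ E) (hρ : 0 ≤ ρ) (δ : ℝ) :
    RateCondition R P (additive d) (E - (1 + ρ) * (2 * δ)) δ := by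
  refine RateCondition.of_forall fun Q hQ h1 h2 hd => ?_
  have := h Q hQ h1 h2
  have h3 : (1 + ρ) * (2 * δ) ≤ (1 + ρ) * (mutualInfo Q Prod.fst Prod.snd - R) := by linarith
  linarith [le_of_mul_le_mul_left h3 (by linarith)]

theorem mutualInfo_law (V : X × X × Y → ℝ) :
    mutualInfo (law V cXX') Prod.fst Prod.snd = mutualInfo V cX cX' := by
  simp only [mutualInfo, law_law]
  rfl

theorem SatisfiesLagrangeBound.le_rgvExponent {R : ℝ} {P : X → ℝ} {W : X → Y → ℝ}
    (hW : ∀ x, W x ∈ stdSimplex ℝ Y) {q : X → Y → ℝ} {s ρ E : ℝ} (hs : 0 ≤ s)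
    (h : SatisfiesLagrangeBound R P (chernoff W q s) ρ E) (hρ : 0 ≤ ρ) {δ : ℝ} :
    ((E - 2 * δ * ρ : ℝ) : EReal) ≤ rgvExponent R P W (additive q) (additive (chernoff W q s))
      (E - (1 + ρ) * (2 * δ)) := by
  refine le_iInf₂ fun V hV => ?_
  obtain ⟨⟨hV0, hX, hX', hq⟩, hΔ⟩ := hV
  subst hX
  refine le_objective hV0.1 fun hac => ?_
  have h1 := chernoff_add_mutualInfo_le hV0 hW hs hq hac
  have h2 := h _ (law_mem_stdSimplex hV0 cXX') (by rw [law_law]; rfl) (by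
    rw [law_law, ← hX']; rfl)
  rw [mutualInfo_law] at h2
  have h3 := le_max_left (mutualInfo V cX' cXY - R) 0
  -- For small I - R the Lagrange bound loses only ρ(I - R) ≤ 2δρ; for large I - R the constraint d
  -- ≥ Δ suffices.
  rcases le_total (mutualInfo V cX cX' - R) (2 * δ) with ht | ht
  · have := mul_le_mul_of_nonneg_left ht hρ
    linarith
  · linarith

theorem sum_exp_pos {P : X → ℝ} (hP : P ∈ stdSimplex ℝ X) (d : X → X → ℝ) (ρ : ℝ) (a : X → ℝ)
    (x : X) : 0 < ∑ x', P x' * Real.exp (-(d x x') / (1 + ρ)) *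
      (Real.exp (a x') / Real.exp (a x)) := by
  obtain ⟨x₀, -, hx₀⟩ := Finset.exists_ne_zero_of_sum_ne_zero
    (by rw [hP.2]; exact one_ne_zero)
  exact Finset.sum_pos'
    (fun x' _ => mul_nonneg (mul_nonneg (hP.1 x') (by positivity)) (by positivity))
    ⟨x₀, Finset.mem_univ _, mul_pos (mul_pos ((hP.1 x₀).lt_of_ne' hx₀) (by positivity))
      (by positivity)⟩

/-- The dual bound on `d + (1 + ρ)(I - R)`. -/
theorem satisfiesLagrangeBound_exDualObjective (R : ℝ) {P : X → ℝ} (hP : P ∈ stdSimplex ℝ X)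
    (d : X → X → ℝ) {ρ : ℝ} (hρ : 0 ≤ ρ) (a : X → ℝ) :
    SatisfiesLagrangeBound R P d ρ (exDualObjective R P d ρ a) := by
  intro Q hQ h1 h2
  set Z : X → ℝ := fun x => ∑ x', P x' * Real.exp (-(d x x') / (1 + ρ)) *
    (Real.exp (a x') / Real.exp (a x)) with hZ
  have hZpos : ∀ x, 0 < Z x := sum_exp_pos hP d ρ a
  -- The Gibbs coupling at temperature 1+ρ, the weight of I in the bound. Multiplying D(Q‖N) ≥ 0 by
  -- 1+ρ gives the claim; the `a` terms cancel because both marginals of `Q` are `P`.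
  set N : X × X → ℝ := fun p => P p.1 * (P p.2 * Real.exp (-(d p.1 p.2) / (1 + ρ)) *
    (Real.exp (a p.2) / Real.exp (a p.1))) / Z p.1 with hN
  have hN1 : ∑ p, N p = 1 := by
    rw [Fintype.sum_prod_type]
    simp only [hN, ← Finset.sum_div, ← Finset.mul_sum]
    exact (Finset.sum_congr rfl fun x _ => mul_div_cancel_right₀ _ (hZpos x).ne').trans hP.2
  have hpos : ∀ p, Q p ≠ 0 → P p.1 ≠ 0 ∧ P p.2 ≠ 0 := fun p hp =>
    ⟨by rw [← h1]; exact (law_pos hQ.1 Prod.fst hp).ne',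
      by rw [← h2]; exact (law_pos hQ.1 Prod.snd hp).ne'⟩
  have key := sum_mul_log_div_nonneg hQ (N := N)
    (fun p => div_nonneg (mul_nonneg (hP.1 _) (mul_nonneg (mul_nonneg (hP.1 _) (by positivity))
      (by positivity))) (hZpos _).le) hN1.le
    (fun p hp => div_ne_zero (mul_ne_zero (hpos p hp).1 (mul_ne_zero (mul_ne_zero (hpos p hp).2
      (Real.exp_ne_zero _)) (by positivity))) (hZpos _).ne')
  have hS : exSum P d ρ a = ∑ p, Q p * Real.log (Z p.1) := by
    rw [exSum, ← h1, sum_law_mul Q Prod.fst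
      (fun x => Real.log (∑ x', law Q Prod.fst x' * Real.exp (-(d x x') / (1 + ρ)) *
    (Real.exp (a x') / Real.exp (a x)))), h1]
  have hd : additive d Q = ∑ p, Q p * d p.1 p.2 := by
    rw [Fintype.sum_prod_type]; rfl
  have ha : ∑ p, Q p * a p.1 = ∑ p, Q p * a p.2 := by
    rw [← sum_law_mul Q Prod.fst a, ← sum_law_mul Q Prod.snd a, h1, h2]
  have hI : mutualInfo Q Prod.fst Prod.snd = ∑ p, Q p * Real.log (Q p / N p) +
      (∑ p, Q p * a p.2 - ∑ p, Q p * a p.1) - (∑ p, Q p * d p.1 p.2) / (1 + ρ) -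
      ∑ p, Q p * Real.log (Z p.1) := by
    rw [mutualInfo_eq_sum, Finset.sum_div, ← Finset.sum_sub_distrib, ← Finset.sum_add_distrib,
      ← Finset.sum_sub_distrib, ← Finset.sum_sub_distrib]
    refine Finset.sum_congr rfl fun p _ => ?_
    by_cases hp : Q p = 0
    · simp [hp]
    obtain ⟨hp1, hp2⟩ := hpos p hp
    have hl : law Q (fun p => (p.1, p.2)) (p.1, p.2) = Q p :=
      law_of_injective Q (f := fun p => (p.1, p.2)) (fun _ _ h => h) p
    rw [hl, h1, h2]
    simp only [hN]
    rw [Real.log_div hp (mul_ne_zero hp1 hp2), Real.log_mul hp1 hp2, Real.log_div hp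
      (div_ne_zero (mul_ne_zero hp1 (mul_ne_zero (mul_ne_zero hp2
      (Real.exp_ne_zero _)) (by positivity))) (hZpos _).ne'), Real.log_div (mul_ne_zero hp1
      (mul_ne_zero (mul_ne_zero hp2 (Real.exp_ne_zero _)) (by positivity))) (hZpos _).ne',
      Real.log_mul hp1 (mul_ne_zero (mul_ne_zero hp2 (Real.exp_ne_zero _)) (by positivity)),
      Real.log_mul (mul_ne_zero hp2 (Real.exp_ne_zero _)) (by positivity),
      Real.log_mul hp2 (Real.exp_ne_zero _), Real.log_exp, ← Real.exp_sub, Real.log_exp]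
    ring
  rw [exDualObjective, hS, hd, hI, ha]
  have h4 : (1 + ρ) * ((∑ p, Q p * d p.1 p.2) / (1 + ρ)) = ∑ p, Q p * d p.1 p.2 := by
    field_simp
  have := mul_nonneg (by linarith : 0 ≤ 1 + ρ) key
  linarith

/-! ### The random-coding exponents lie below the RGV exponent. -/

theorem sum_law_prod_left {A B C : Type*} [Fintype A] [Fintype B] (V : A → ℝ) (f : A → B)
    (g : A → C) (c : C) : ∑ b, law V (fun a => (f a, g a)) (b, c) = law V g c := by
  classical
  simp only [law, Prod.mk.injEq]
  rw [Finset.sum_comm]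
  refine Finset.sum_congr rfl fun a _ => ?_
  by_cases h : g a = c <;> simp [h]

/-- Data processing: `I(X̃; Y) ≤ I(X̃; Y, X)`. -/
theorem mutualInfo_le_mutualInfo_pair {V : X × X × Y → ℝ} (hV : V ∈ stdSimplex ℝ (X × X × Y)) :
    mutualInfo V cX' cY ≤ mutualInfo V cX' cXY := by
  -- The Markov law X - Y - X̃: the difference of the two informations is I(X̃;X|Y) = D(V‖N).
  set N : X × X × Y → ℝ := fun v => law V cXY (cXY v) * law V cX'Y (cX'Y v) / law V cY v.2.2
    with hN
  have hXY : ∀ y, ∑ x, law V cXY (x, y) = law V cY y := sum_law_prod_left V cX cY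
  have hX'Y : ∀ y, ∑ x, law V cX'Y (x, y) = law V cY y := sum_law_prod_left V cX' cY
  have hN1 : ∑ v, N v = 1 := by
    have h1 : ∑ v, N v = ∑ y, ∑ x, ∑ x', N (x, x', y) := by
      rw [sum_triple]
      calc _ = ∑ x, ∑ y, ∑ x', N (x, x', y) :=
            Finset.sum_congr rfl fun x _ => Finset.sum_comm
        _ = _ := Finset.sum_comm
    rw [h1, ← hV.2, ← sum_law V cY]
    refine Finset.sum_congr rfl fun y _ => ?_
    simp only [hN, cXY, cX'Y, ← Finset.sum_div, ← Finset.mul_sum, ← Finset.sum_mul, hXY, hX'Y]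
    -- V_Y²/V_Y = V_Y holds also at `0`, as division by zero gives `0`.
    exact mul_self_div_self _
  have key := sum_mul_log_div_nonneg hV (N := N)
    (fun v => div_nonneg (mul_nonneg (law_nonneg hV.1 _ _) (law_nonneg hV.1 _ _))
      (law_nonneg hV.1 _ _)) hN1.le (fun v hv => div_ne_zero (mul_ne_zero
      (law_pos hV.1 cXY hv).ne' (law_pos hV.1 cX'Y hv).ne') (law_pos hV.1 cY hv).ne')
  rw [← sub_nonneg]
  refine key.trans_eq ?_
  rw [mutualInfo_eq_sum, mutualInfo_eq_sum, ← Finset.sum_sub_distrib]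
  refine Finset.sum_congr rfl fun v _ => ?_
  by_cases hv : V v = 0
  · simp [hv]
  have h1 := (law_pos hV.1 cY hv).ne'
  have h2 := (law_pos hV.1 cX' hv).ne'
  have h3 := (law_pos hV.1 cXY hv).ne'
  have h4 := (law_pos hV.1 cX'Y hv).ne'
  rw [law_self_apply]
  change V v * Real.log (V v / (_ / law V cY (cY v))) = _ -
    V v * Real.log (law V cX'Y (cX'Y v) / _)
  rw [Real.log_div hv (div_ne_zero (mul_ne_zero h3 h4) h1), Real.log_div (mul_ne_zero h3 h4) h1,
    Real.log_mul h3 h4, Real.log_div hv (mul_ne_zero h2 h3), Real.log_mul h2 h3,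
    Real.log_div h4 (mul_ne_zero h2 h1), Real.log_mul h2 h1]
  ring

theorem rcExponent_le_rgvExponent (R : ℝ) (P : X → ℝ) (W : X → Y → ℝ) (q : (X × Y → ℝ) → ℝ)
    (d : (X × X → ℝ) → ℝ) (Δ : ℝ) : rcExponent R P W q ≤ rgvExponent R P W q d Δ := by
  refine le_iInf₂ fun V hV => (iInf₂_le V hV.1).trans ?_
  gcongr
  exact mutualInfo_le_mutualInfo_pair hV.1.1

/-- Weak duality for the random-coding exponent. -/
theorem rcDual_objective_le {V : X × X × Y → ℝ} (hV : V ∈ stdSimplex ℝ (X × X × Y))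
    (hXX' : law V cX' = law V cX) {W : X → Y → ℝ} (hW : ∀ x, W x ∈ stdSimplex ℝ Y)
    {q : X → Y → ℝ} (hq : additive q (law V cXY) ≤ additive q (law V cX'Y))
    (hac : ∀ v, V v ≠ 0 → W v.1 v.2.2 ≠ 0) {ρ s : ℝ} (hρ : 0 ≤ ρ) (hs : 0 ≤ s) (a : X → ℝ) :
    -(∑ x, law V cX x * Real.log (∑ y, W x y *
      ((∑ x', law V cX x' * Real.exp (s * q x' y) * Real.exp (a x')) /
        (Real.exp (s * q x y) * Real.exp (a x))) ^ ρ)) ≤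
      (∑ v, V v * Real.log (law V cXY (cXY v) / law V cX v.1 / W v.1 v.2.2)) +
        ρ * mutualInfo V cX' cXY := by
  set P := law V cX with hP
  have hPs : P ∈ stdSimplex ℝ X := law_mem_stdSimplex hV cX
  set C : Y → ℝ := fun y => ∑ x', P x' * Real.exp (s * q x' y) * Real.exp (a x') with hC
  set G : X → Y → ℝ := fun x y => C y / (Real.exp (s * q x y) * Real.exp (a x)) with hG
  set B : X → ℝ := fun x => ∑ y, W x y * G x y ^ ρ with hB
  have hCpos : ∀ y, 0 < C y := by
    obtain ⟨x₀, -, hx₀⟩ := Finset.exists_ne_zero_of_sum_ne_zero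
      (by rw [hPs.2]; exact one_ne_zero)
    exact fun y => Finset.sum_pos'
      (fun x' _ => mul_nonneg (mul_nonneg (hPs.1 x') (Real.exp_pos _).le) (Real.exp_pos _).le)
      ⟨x₀, Finset.mem_univ _, mul_pos (mul_pos ((hPs.1 x₀).lt_of_ne' hx₀) (Real.exp_pos _))
        (Real.exp_pos _)⟩
  have hGpos : ∀ x y, 0 < G x y := fun x y => div_pos (hCpos y) (by positivity)
  have hBpos : ∀ x, 0 < B x := by
    intro x
    obtain ⟨y, -, hy⟩ := Finset.exists_ne_zero_of_sum_ne_zero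
      (by rw [(hW x).2]; exact one_ne_zero)
    exact Finset.sum_pos' (fun y _ => mul_nonneg ((hW x).1 y) (Real.rpow_pos_of_pos (hGpos x y) _).le)
      ⟨y, Finset.mem_univ _, mul_pos (((hW x).1 y).lt_of_ne' hy)
        (Real.rpow_pos_of_pos (hGpos x y) _)⟩
  -- Divergence of V_{XY} from P times the channel W G^ρ / B: it bounds D(V_{Y|X}‖W|P) below by ρ
  -- E[log G] - ∑ P log B.
  have key1 : 0 ≤ ∑ v, V v * Real.log (law V cXY (cXY v) /
      (P v.1 * (W v.1 v.2.2 * G v.1 v.2.2 ^ ρ) / B v.1)) := by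
    refine le_of_le_of_eq ?_ (sum_law_mul V cXY (fun p => Real.log (law V cXY p /
      (P p.1 * (W p.1 p.2 * G p.1 p.2 ^ ρ) / B p.1))))
    refine sum_mul_log_div_nonneg (law_mem_stdSimplex hV cXY)
      (fun p => div_nonneg (mul_nonneg (hPs.1 _) (mul_nonneg ((hW _).1 _)
        (Real.rpow_pos_of_pos (hGpos _ _) _).le)) (hBpos _).le) (le_of_eq ?_) ?_
    · rw [Fintype.sum_prod_type]
      simp only [← Finset.sum_div, ← Finset.mul_sum]
      exact (Finset.sum_congr rfl fun x _ => mul_div_cancel_right₀ _ (hBpos x).ne').trans hPs.2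
    · intro p hp
      obtain ⟨v, rfl, hv⟩ := exists_of_law_ne_zero hp
      exact div_ne_zero (mul_ne_zero (law_pos hV.1 cX hv).ne' (mul_ne_zero (hac v hv)
        (Real.rpow_pos_of_pos (hGpos _ _) _).ne')) (hBpos _).ne'
  -- Replacing the law of X̃ given (X, Y) by the posterior proportional to P e^{sq+a} gives
  -- I(X̃;Y,X) + E[log G] ≥ 0; the metric constraint has the right sign, and the `a` terms cancel.
  have key2 := sum_mul_log_div_nonneg hV (N := fun v => law V cXY (cXY v) *
      (P v.2.1 * Real.exp (s * q v.2.1 v.2.2) * Real.exp (a v.2.1)) / C v.2.2)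
    (fun v => div_nonneg (mul_nonneg (law_nonneg hV.1 _ _) (mul_nonneg (mul_nonneg (hPs.1 _)
      (Real.exp_pos _).le) (Real.exp_pos _).le)) (hCpos _).le) (by
      refine le_of_eq ?_
      rw [sum_triple, ← hV.2, ← sum_law V cXY, Fintype.sum_prod_type]
      refine Finset.sum_congr rfl fun x _ => ?_
      rw [Finset.sum_comm]
      refine Finset.sum_congr rfl fun y _ => ?_
      simp only [cXY, ← Finset.sum_div, ← Finset.mul_sum]
      exact mul_div_cancel_right₀ _ (hCpos y).ne')
    (fun v hv => div_ne_zero (mul_ne_zero (law_pos hV.1 cXY hv).ne' (mul_ne_zero (mul_ne_zero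
      (by rw [← hXX']; exact (law_pos hV.1 cX' hv).ne') (Real.exp_ne_zero _))
      (Real.exp_ne_zero _))) (hCpos _).ne')
  have hq' := mul_le_mul_of_nonneg_left (metric_le hq) hs
  have ha : ∑ v, V v * a v.1 = ∑ v, V v * a v.2.1 := by
    have h1 := sum_law_mul V cX a
    have h2 := sum_law_mul V cX' a
    rw [hXX'] at h2
    exact h1.symm.trans h2
  have e1 : ∑ v, V v * Real.log (law V cXY (cXY v) /
      (P v.1 * (W v.1 v.2.2 * G v.1 v.2.2 ^ ρ) / B v.1)) =
      (∑ v, V v * Real.log (law V cXY (cXY v) / P v.1 / W v.1 v.2.2)) -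
      ρ * ∑ v, V v * Real.log (G v.1 v.2.2) + ∑ x, P x * Real.log (B x) := by
    rw [sum_law_mul V cX (fun x => Real.log (B x)), Finset.mul_sum, ← Finset.sum_sub_distrib,
      ← Finset.sum_add_distrib]
    refine Finset.sum_congr rfl fun v _ => ?_
    by_cases hv : V v = 0
    · simp [hv]
    have h1 : P v.1 ≠ 0 := (law_pos hV.1 cX hv).ne'
    have h3 := (law_pos hV.1 cXY hv).ne'
    have h5 := hac v hv
    have h6 := (Real.rpow_pos_of_pos (hGpos v.1 v.2.2) ρ).ne'
    rw [Real.log_div h3 (div_ne_zero (mul_ne_zero h1 (mul_ne_zero h5 h6)) (hBpos _).ne'),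
      Real.log_div (mul_ne_zero h1 (mul_ne_zero h5 h6)) (hBpos _).ne',
      Real.log_mul h1 (mul_ne_zero h5 h6), Real.log_mul h5 h6, Real.log_rpow (hGpos _ _),
      Real.log_div (div_ne_zero h3 h1) h5, Real.log_div h3 h1]
    simp only [cX]
    ring
  have e2 : ∑ v, V v * Real.log (V v / (law V cXY (cXY v) *
      (P v.2.1 * Real.exp (s * q v.2.1 v.2.2) * Real.exp (a v.2.1)) / C v.2.2)) =
      mutualInfo V cX' cXY + ∑ v, V v * Real.log (G v.1 v.2.2) +
      (s * ∑ v, V v * q v.1 v.2.2 - s * ∑ v, V v * q v.2.1 v.2.2) +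
      (∑ v, V v * a v.1 - ∑ v, V v * a v.2.1) := by
    rw [mutualInfo_eq_sum, Finset.mul_sum, Finset.mul_sum, ← Finset.sum_sub_distrib,
      ← Finset.sum_sub_distrib, ← Finset.sum_add_distrib, ← Finset.sum_add_distrib,
      ← Finset.sum_add_distrib]
    refine Finset.sum_congr rfl fun v _ => ?_
    by_cases hv : V v = 0
    · simp [hv]
    have h2 := (law_pos hV.1 cX' hv).ne'
    have h2' : P v.2.1 ≠ 0 := by rw [← hXX']; exact h2
    have h3 := (law_pos hV.1 cXY hv).ne'
    have h4 := (Real.exp_ne_zero (s * q v.2.1 v.2.2))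
    have h5 := (Real.exp_ne_zero (a v.2.1))
    have h6 := (hCpos v.2.2).ne'
    rw [law_self_apply, Real.log_div hv (div_ne_zero (mul_ne_zero h3 (mul_ne_zero
      (mul_ne_zero h2' h4) h5)) h6), Real.log_div (mul_ne_zero h3 (mul_ne_zero
      (mul_ne_zero h2' h4) h5)) h6, Real.log_mul h3 (mul_ne_zero (mul_ne_zero h2' h4) h5),
      Real.log_mul (mul_ne_zero h2' h4) h5, Real.log_mul h2' h4, Real.log_exp, Real.log_exp,
      Real.log_div hv (mul_ne_zero h2 h3), Real.log_mul h2 h3, hXX']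
    simp only [hG]
    rw [Real.log_div h6 (mul_ne_zero (Real.exp_ne_zero _) (Real.exp_ne_zero _)),
      Real.log_mul (Real.exp_ne_zero _) (Real.exp_ne_zero _), Real.log_exp, Real.log_exp]
    simp only [cX']
    ring
  rw [e1] at key1
  rw [e2] at key2
  have h3 : 0 ≤ mutualInfo V cX' cXY + ∑ v, V v * Real.log (G v.1 v.2.2) := by linarith
  have h4 := mul_nonneg hρ h3
  linarith

theorem rcDual_le_rgvExponent (R : ℝ) (P : X → ℝ) {W : X → Y → ℝ}
    (hW : ∀ x, W x ∈ stdSimplex ℝ Y) (q : X → Y → ℝ) (d : (X × X → ℝ) → ℝ) (Δ : ℝ) :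
    rcDual R P W q ≤ rgvExponent R P W (additive q) d Δ := by
  refine iSup_le fun ρ => iSup_le fun hρ => iSup_le fun s => iSup_le fun hs => iSup_le fun a =>
    le_iInf₂ fun V hV => ?_
  obtain ⟨⟨hV0, hX, hX', hq⟩, -⟩ := hV
  subst hX
  refine le_objective hV0.1 fun hac => ?_
  have h1 := rcDual_objective_le hV0 hX' hW hq hac hρ.1 hs a
  -- Since ρ ∈ [0,1], ρt ≤ |t|₊.
  have h2 : ρ * (mutualInfo V cX' cXY - R) ≤ max (mutualInfo V cX' cXY - R) 0 := by
    have h3 := le_max_left (mutualInfo V cX' cXY - R) 0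
    have h4 := le_max_right (mutualInfo V cX' cXY - R) 0
    exact (mul_le_mul_of_nonneg_left h3 hρ.1).trans (mul_le_of_le_one_left h4 hρ.2)
  linarith

theorem zero_le_rcDual (R : ℝ) (P : X → ℝ) {W : X → Y → ℝ}
    (hW : ∀ x, W x ∈ stdSimplex ℝ Y) (q : X → Y → ℝ) : 0 ≤ rcDual R P W q := by
  refine le_iSup_of_le 0 (le_iSup_of_le ⟨le_rfl, zero_le_one⟩ (le_iSup_of_le 0
    (le_iSup_of_le le_rfl (le_iSup_of_le 0 ?_))))
  simp [(hW _).2]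

theorem additive_eq_sum {A B : Type*} [Fintype A] [Fintype B] (h : A → B → ℝ) (Q : A × B → ℝ) :
    additive h Q = ∑ p, Q p * h p.1 p.2 := by
  rw [Fintype.sum_prod_type]; rfl

/-- An average of distances exceeding Δ exceeds Δ, so no coupling is left in the minimum. -/
theorem rateCondition_of_lt (R : ℝ) (P : X → ℝ) {d : X → X → ℝ} {Δ : ℝ}
    (h : ∀ x x', Δ < d x x') (δ : ℝ) : RateCondition R P (additive d) Δ δ := by
  refine RateCondition.of_forall fun Q hQ _ _ hd => absurd hd (not_le.2 ?_)
  rw [additive_eq_sum]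
  obtain ⟨p, -, hp⟩ := Finset.exists_ne_zero_of_sum_ne_zero
    (by rw [hQ.2]; exact one_ne_zero)
  calc Δ = ∑ p, Q p * Δ := by rw [← Finset.sum_mul, hQ.2, one_mul]
    _ < _ := Finset.sum_lt_sum (fun p _ => mul_le_mul_of_nonneg_left (h _ _).le (hQ.1 p))
      ⟨p, Finset.mem_univ _, mul_lt_mul_of_pos_left (h _ _) ((hQ.1 p).lt_of_ne' hp)⟩

/-! ### The primal expurgated exponent as a convex programme. -/

section Convex

variable {A : Type*} [Fintype A]

/-- The divergence of `Q` from the measure with log-density `c`. -/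
def logDiv (c : A → ℝ) (Q : A → ℝ) : ℝ := ∑ a, (Q a * Real.log (Q a) - Q a * c a)

theorem continuous_logDiv (c : A → ℝ) : Continuous (logDiv c) :=
  continuous_finsetSum _ fun a _ =>
    (Real.continuous_mul_log.comp (continuous_apply a)).sub (by fun_prop)

theorem convexOn_logDiv (c : A → ℝ) : ConvexOn ℝ (stdSimplex ℝ A) (logDiv c) := by
  refine ⟨convex_stdSimplex ℝ A, fun Q hQ Q' hQ' s t hs ht hst => ?_⟩
  simp only [logDiv, smul_eq_mul, Finset.mul_sum, ← Finset.sum_add_distrib]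
  refine Finset.sum_le_sum fun a _ => ?_
  have := Real.convexOn_mul_log.2 (hQ.1 a) (hQ'.1 a) hs ht hst
  simp only [smul_eq_mul] at this
  simp only [Pi.add_apply, Pi.smul_apply, smul_eq_mul]
  linarith

theorem convexOn_logDiv_sub {K : Set (A → ℝ)} (hK : Convex ℝ K) (hsub : K ⊆ stdSimplex ℝ A)
    (c : A → ℝ) (R : ℝ) : ConvexOn ℝ K fun Q => logDiv c Q - R := by
  simp only [sub_eq_add_neg]
  exact ((convexOn_logDiv c).subset hsub hK).add_const (-R)

end Convex


/-- The couplings of `P` with itself. -/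
def couplings (P : X → ℝ) : Set (X × X → ℝ) :=
  {Q | Q ∈ stdSimplex ℝ (X × X) ∧ law Q Prod.fst = P ∧ law Q Prod.snd = P}

theorem convex_couplings (P : X → ℝ) : Convex ℝ (couplings P) := by
  rintro Q ⟨hQ, h1, h2⟩ Q' ⟨hQ', h1', h2'⟩ s t hs ht hst
  refine ⟨convex_stdSimplex ℝ _ hQ hQ' hs ht hst, ?_, ?_⟩
  · rw [law_add_smul, h1, h1', ← add_smul, hst, one_smul]
  · rw [law_add_smul, h2, h2', ← add_smul, hst, one_smul]

theorem isCompact_couplings (P : X → ℝ) : IsCompact (couplings P) :=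
  (isCompact_stdSimplex ℝ (X × X)).of_isClosed_subset
    ((isClosed_stdSimplex ℝ _).inter ((isClosed_eq (continuous_law _) continuous_const).inter
      (isClosed_eq (continuous_law _) continuous_const))) fun _ hQ => hQ.1

/-- Fixed marginals make the denominator constant; this supplies convexity and continuity of the
information on couplings. -/
theorem mutualInfo_eq_logDiv {P : X → ℝ} {Q : X × X → ℝ} (hQ : Q ∈ couplings P) :
    mutualInfo Q Prod.fst Prod.snd = logDiv (fun p => Real.log (P p.1 * P p.2)) Q := by
  obtain ⟨hQ, h1, h2⟩ := hQ
  rw [mutualInfo_eq_sum, logDiv]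
  refine Finset.sum_congr rfl fun p _ => ?_
  by_cases hp : Q p = 0
  · simp [hp]
  have hp1 : P p.1 ≠ 0 := by rw [← h1]; exact (law_pos hQ.1 Prod.fst hp).ne'
  have hp2 : P p.2 ≠ 0 := by rw [← h2]; exact (law_pos hQ.1 Prod.snd hp).ne'
  rw [law_of_injective Q (f := fun p => (p.1, p.2)) (fun _ _ h => h) p, h1, h2,
    Real.log_div hp (mul_ne_zero hp1 hp2), mul_sub]

theorem law_cXX'_mem_couplings {P : X → ℝ} {V : X × X × Y → ℝ}
    (hV : V ∈ stdSimplex ℝ (X × X × Y)) (h1 : law V cX = P) (h2 : law V cX' = P) :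
    law V cXX' ∈ couplings P :=
  ⟨law_mem_stdSimplex hV _, by rw [law_law]; exact h1, by rw [law_law]; exact h2⟩

/-- The feasible set of the expurgated exponent without the metric constraint. -/
def exSet (R : ℝ) (P : X → ℝ) (W : X → Y → ℝ) : Set (X × X × Y → ℝ) :=
  {V | V ∈ stdSimplex ℝ (X × X × Y) ∧ law V cX = P ∧ law V cX' = P ∧
    (∀ v, W v.1 v.2.2 = 0 → V v = 0) ∧
    logDiv (fun p => Real.log (P p.1 * P p.2)) (law V cXX') ≤ R}

theorem convex_exSet (R : ℝ) (P : X → ℝ) (W : X → Y → ℝ) : Convex ℝ (exSet R P W) := by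
  rintro V ⟨hV, h1, h2, h3, h4⟩ V' ⟨hV', h1', h2', h3', h4'⟩ s t hs ht hst
  refine ⟨convex_stdSimplex ℝ _ hV hV' hs ht hst, ?_, ?_, fun v hv => ?_, ?_⟩
  · rw [law_add_smul, h1, h1', ← add_smul, hst, one_smul]
  · rw [law_add_smul, h2, h2', ← add_smul, hst, one_smul]
  · simp [h3 v hv, h3' v hv]
  · rw [law_add_smul]
    refine ((convexOn_logDiv _).2 (law_mem_stdSimplex hV _) (law_mem_stdSimplex hV' _)
      hs ht hst).trans ?_
    calc _ ≤ s • R + t • R := by gcongr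
      _ = R := by rw [← add_smul, hst, one_smul]

theorem isCompact_exSet (R : ℝ) (P : X → ℝ) (W : X → Y → ℝ) : IsCompact (exSet R P W) := by
  refine (isCompact_stdSimplex ℝ (X × X × Y)).of_isClosed_subset
    ((isClosed_stdSimplex ℝ _).inter ((isClosed_eq (continuous_law _) continuous_const).inter
      ((isClosed_eq (continuous_law _) continuous_const).inter (IsClosed.inter ?_ ?_))))
      fun _ hV => hV.1
  · change IsClosed {V : X × X × Y → ℝ | ∀ v, W v.1 v.2.2 = 0 → V v = 0}
    simp only [Set.ofPred_forall]
    exact isClosed_iInter fun v => isClosed_iInter fun _ =>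
      isClosed_eq (continuous_apply v) continuous_const
  · exact isClosed_le ((continuous_logDiv _).comp (continuous_law _)) continuous_const

/-- The objective of the expurgated exponent is the divergence of `V` from `P × P × W`. -/
theorem lt_logDiv_of_lt_exExponent {E R : ℝ} {P : X → ℝ} {W : X → Y → ℝ} {q : X → Y → ℝ}
    (hE : (E : EReal) < exExponent R P W (additive q)) {V : X × X × Y → ℝ} (hV : V ∈ exSet R P W)
    (hq : ∑ v, V v * (q v.1 v.2.2 - q v.2.1 v.2.2) ≤ 0) :
    E < logDiv (fun v : X × X × Y => Real.log (P v.1 * P v.2.1 * W v.1 v.2.2)) V - R := by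
  obtain ⟨hV0, h1, h2, h3, h4⟩ := hV
  -- As `Real.log 0 = 0`, `logDiv` does not see an infinite divergence; absolute continuity comes
  -- from the support constraint in `exSet`.
  have hac : ∀ v, V v ≠ 0 → W v.1 v.2.2 ≠ 0 := fun v hv hw => hv (h3 v hw)
  rw [← mutualInfo_eq_logDiv (law_cXX'_mem_couplings hV0 h1 h2), mutualInfo_law] at h4
  have hmem : V ∈ metricSet P (additive q) := by
    refine ⟨hV0, h1, h2, ?_⟩
    rw [additive_law, additive_law, ← sub_nonpos, ← Finset.sum_sub_distrib]
    simpa only [mul_sub, cXY, cX'Y] using hq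
  have hlt := hE.trans_le (iInf₂_le V ⟨hmem, h4⟩)
  rw [condDiv_eq_sum hV0.1 cXX' cY (fun p => W p.1) hac, ← EReal.coe_add,
    EReal.coe_lt_coe_iff] at hlt
  refine hlt.trans_eq ?_
  rw [← add_sub_assoc, mutualInfo_eq_sum, ← Finset.sum_add_distrib, logDiv]
  congr 1
  refine Finset.sum_congr rfl fun v _ => ?_
  by_cases hv : V v = 0
  · simp [hv]
  have hp1 : P v.1 ≠ 0 := by rw [← h1]; exact (law_pos hV0.1 cX hv).ne'
  have hp2 : P v.2.1 ≠ 0 := by rw [← h2]; exact (law_pos hV0.1 cX' hv).ne'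
  have h5 := (law_pos hV0.1 cXX' hv).ne'
  have h6 := hac v hv
  rw [law_self_apply', h1, h2]
  change V v * Real.log (V v / law V cXX' (cXX' v) / W v.1 v.2.2) +
    V v * Real.log (law V cXX' (cXX' v) / (P v.1 * P v.2.1)) = _
  rw [Real.log_div (div_ne_zero hv h5) h6, Real.log_div hv h5,
    Real.log_div h5 (mul_ne_zero hp1 hp2), Real.log_mul (mul_ne_zero hp1 hp2) h6]
  ring

/-- The joint pmf with pair marginal `Q` and the tilted conditional law of `Y`. -/
def tilted (W : X → Y → ℝ) (q : X → Y → ℝ) (s : ℝ) (Q : X × X → ℝ) : X × X × Y → ℝ := fun v =>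
  Q (cXX' v) * (W v.1 v.2.2 *
    Real.exp (s * (q v.2.1 v.2.2 - q v.1 v.2.2) + chernoff W q s v.1 v.2.1))

theorem law_tilted {W : X → Y → ℝ} (hW : ∀ x, W x ∈ stdSimplex ℝ Y) (q : X → Y → ℝ) (s : ℝ)
    (Q : X × X → ℝ) : law (tilted W q s Q) cXX' = Q := by
  classical
  funext p
  have h1 : ∀ x x', ∑ y, tilted W q s Q (x, x', y) = Q (x, x') := fun x x' => by
    simp only [tilted, cXX', ← Finset.mul_sum]
    rw [sum_tilted hW, mul_one]
  have h : ∀ e : X × X → ℝ, ∑ p, law (tilted W q s Q) cXX' p * e p = ∑ p, Q p * e p := fun e => by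
    rw [sum_law_mul, sum_triple, Fintype.sum_prod_type]
    simp only [cXX', ← Finset.sum_mul, h1]
  simpa [Pi.single_apply] using h (Pi.single p 1)

/-- The constraints are priced one at a time: first the metric, then, after minimizing over the law
of Y given (X, X̃), the information. -/
theorem exists_satisfiesLagrangeBound {E R : ℝ} {P : X → ℝ} {W : X → Y → ℝ}
    (hW : ∀ x, W x ∈ stdSimplex ℝ Y) {q : X → Y → ℝ}
    (hE : (E : EReal) < exExponent R P W (additive q)) :
    ∃ s ρ : ℝ, 0 ≤ s ∧ 0 ≤ ρ ∧ SatisfiesLagrangeBound R P (chernoff W q s) ρ E := by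
  -- Each use of the multiplier lemma needs a strict gap, so the slack is split at E'.
  obtain ⟨E', hE1, hE2⟩ := EReal.lt_iff_exists_real_btwn.1 hE
  rw [EReal.coe_lt_coe_iff] at hE1
  have hg : ConvexOn ℝ (exSet R P W) fun V => ∑ v, V v * (q v.1 v.2.2 - q v.2.1 v.2.2) := by
    refine ⟨convex_exSet R P W, fun V _ V' _ s t _ _ _ => le_of_eq ?_⟩
    simp only [smul_eq_mul, Finset.mul_sum, ← Finset.sum_add_distrib, Pi.add_apply, Pi.smul_apply]
    exact Finset.sum_congr rfl fun v _ => by ring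
  obtain ⟨s, hs, hbound⟩ := exists_lagrange_multiplier (isCompact_exSet R P W)
    (f := fun V => logDiv (fun v : X × X × Y => Real.log (P v.1 * P v.2.1 * W v.1 v.2.2)) V - R)
    (convexOn_logDiv_sub (convex_exSet R P W) (fun V hV => hV.1) _ R)
    hg ((continuous_logDiv _).sub continuous_const).continuousOn
    (by fun_prop) (fun V hV hq => lt_logDiv_of_lt_exExponent hE2 hV hq)
  set c : X × X → ℝ := fun p => Real.log (P p.1 * P p.2) with hc
  have hf2 : ∀ Q : X × X → ℝ, logDiv (fun p => c p - chernoff W q s p.1 p.2) Q =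
      logDiv c Q + additive (chernoff W q s) Q := fun Q => by
    rw [additive_eq_sum, logDiv, logDiv, ← Finset.sum_add_distrib]
    exact Finset.sum_congr rfl fun p _ => by ring
  obtain ⟨ρ, hρ, hbound2⟩ := exists_lagrange_multiplier (isCompact_couplings P)
    (f := fun Q => logDiv (fun p => c p - chernoff W q s p.1 p.2) Q - R)
    (g := fun Q => logDiv c Q - R) (c := E)
    (convexOn_logDiv_sub (convex_couplings P) (fun V hV => hV.1) _ R)
    (convexOn_logDiv_sub (convex_couplings P) (fun V hV => hV.1) _ R)
    ((continuous_logDiv _).sub continuous_const).continuousOn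
    ((continuous_logDiv _).sub continuous_const).continuousOn (by
      intro Q hQ hI
      refine hE1.trans_le ?_
      -- The tilted law minimizes the first Lagrangian among laws with pair marginal `Q`; its value
      -- there is I(Q) + d_s(Q) - R.
      set V := tilted W q s Q with hV
      have hlaw : law V cXX' = Q := law_tilted hW q s Q
      have hV0 : V ∈ stdSimplex ℝ (X × X × Y) :=
        ⟨fun v => mul_nonneg (hQ.1.1 _) (mul_nonneg ((hW _).1 _) (Real.exp_pos _).le), by
          rw [← sum_law V cXX', hlaw, hQ.1.2]⟩
      have hVmem : V ∈ exSet R P W := by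
        refine ⟨hV0, ?_, ?_, fun v hv => by simp [hV, tilted, hv], ?_⟩
        · rw [← hQ.2.1, ← hlaw, law_law]; rfl
        · rw [← hQ.2.2, ← hlaw, law_law]; rfl
        · rw [hlaw]; linarith
      refine (hbound V hVmem).trans_eq ?_
      have h1 : logDiv (fun p => c p - chernoff W q s p.1 p.2) Q =
          ∑ v, V v * (Real.log (Q (cXX' v)) - (c (cXX' v) -
            chernoff W q s (cXX' v).1 (cXX' v).2)) := by
        rw [← sum_law_mul V cXX' (fun p => Real.log (Q p) - (c p - chernoff W q s p.1 p.2)), hlaw,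
          logDiv]
        exact Finset.sum_congr rfl fun p _ => by ring
      rw [h1, logDiv, Finset.mul_sum, sub_add_eq_add_sub, ← Finset.sum_add_distrib]
      congr 1
      refine Finset.sum_congr rfl fun v _ => ?_
      by_cases hv : V v = 0
      · simp [hv]
      have hv' := hv
      simp only [hV, tilted] at hv'
      have hQv := left_ne_zero_of_mul hv'
      have hWv := left_ne_zero_of_mul (right_ne_zero_of_mul hv')
      have hP1 : P v.1 ≠ 0 := by rw [← hQ.2.1]; exact (law_pos hQ.1.1 Prod.fst hQv).ne'
      have hP2 : P v.2.1 ≠ 0 := by rw [← hQ.2.2]; exact (law_pos hQ.1.1 Prod.snd hQv).ne'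
      have hlogV : Real.log (V v) = Real.log (Q (cXX' v)) + (Real.log (W v.1 v.2.2) +
          (s * (q v.2.1 v.2.2 - q v.1 v.2.2) + chernoff W q s v.1 v.2.1)) := by
        simp only [hV, tilted]
        rw [Real.log_mul hQv (mul_ne_zero hWv (Real.exp_ne_zero _)),
          Real.log_mul hWv (Real.exp_ne_zero _), Real.log_exp]
      rw [hlogV, Real.log_mul (mul_ne_zero hP1 hP2) hWv]
      simp only [hc, cXX']
      ring)
  refine ⟨s, ρ, hs, hρ, fun Q hQ h1 h2 => ?_⟩
  have hQc : Q ∈ couplings P := ⟨hQ, h1, h2⟩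
  have := hbound2 Q hQc
  rw [mutualInfo_eq_logDiv hQc]
  simp only [hf2] at this
  linarith

/-- The product coupling has I = 0, and d_0 = 0, which leaves E ≤ -(1+ρ)R. This disposes of a
multiplier s = 0. -/
theorem lt_zero_of_chernoff_zero {E R : ℝ} (hR : 0 < R) {P : X → ℝ} (hP : P ∈ stdSimplex ℝ X)
    {W : X → Y → ℝ} (hW : ∀ x, W x ∈ stdSimplex ℝ Y) {q : X → Y → ℝ} {ρ : ℝ} (hρ : 0 ≤ ρ)
    (h : SatisfiesLagrangeBound R P (chernoff W q 0) ρ E) : E < 0 := by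
  classical
  set Q : X × X → ℝ := fun p => P p.1 * P p.2 with hQ
  have h1 : law Q Prod.fst = P := by
    funext x
    simp [law, hQ, Fintype.sum_prod_type, ← Finset.mul_sum, hP.2]
  have h2 : law Q Prod.snd = P := by
    funext x
    simp [law, hQ, Fintype.sum_prod_type, ← Finset.sum_mul, hP.2]
  have hQ0 : Q ∈ stdSimplex ℝ (X × X) :=
    ⟨fun p => mul_nonneg (hP.1 _) (hP.1 _), by rw [← sum_law Q Prod.fst, h1, hP.2]⟩
  have hI : mutualInfo Q Prod.fst Prod.snd = 0 := by
    rw [mutualInfo_eq_logDiv ⟨hQ0, h1, h2⟩]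
    simp [logDiv, hQ]
  have hd : additive (chernoff W q 0) Q = 0 := by
    simp [additive, chernoff, (hW _).2]
  have := h Q hQ0 h1 h2
  rw [hI, hd] at this
  nlinarith

/-! ### ML decoding and the Bhattacharyya distance. -/

omit [Fintype X] in
theorem bhattacharyya_comm (W : X → Y → ℝ) (x x' : X) :
    bhattacharyya W x x' = bhattacharyya W x' x := by
  simp only [bhattacharyya, mul_comm]

omit [Fintype X] [Fintype Y] in
theorem exp_div_exp_of_log {W q : X → Y → ℝ} (hWpos : ∀ x y, 0 < W x y)
    (hq : ∀ x y, q x y = Real.log (W x y)) (x x' : X) (y : Y) :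
    Real.exp (q x' y) / Real.exp (q x y) = W x' y / W x y := by
  rw [hq, hq, Real.exp_log (hWpos _ _), Real.exp_log (hWpos _ _)]

omit [Fintype X] in
theorem chernoff_half {W q : X → Y → ℝ} (hWpos : ∀ x y, 0 < W x y)
    (hq : ∀ x y, q x y = Real.log (W x y)) : chernoff W q (1 / 2) = bhattacharyya W := by
  funext x x'
  rw [chernoff, bhattacharyya]
  congr 2
  refine Finset.sum_congr rfl fun y _ => ?_
  have h1 := hWpos x y
  rw [exp_div_exp_of_log hWpos hq, ← Real.sqrt_eq_rpow]
  calc W x y * √(W x' y / W x y) = √(W x y ^ 2) * √(W x' y / W x y) := by rw [Real.sqrt_sq h1.le]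
    _ = √(W x y ^ 2 * (W x' y / W x y)) := (Real.sqrt_mul (by positivity) _).symm
    _ = _ := by congr 1; field_simp

omit [Fintype X] in
/-- The symmetrized Chernoff distance is largest at `s = 1/2`. -/
theorem chernoff_add_chernoff_le {W q : X → Y → ℝ} (hW : ∀ x, W x ∈ stdSimplex ℝ Y)
    (hWpos : ∀ x y, 0 < W x y) (s : ℝ) (x x' : X) :
    chernoff W q s x x' + chernoff W q s x' x ≤ 2 * bhattacharyya W x x' := by
  have hZ := chernoff_sum_pos hW q s x x'
  have hZ' := chernoff_sum_pos hW q s x' x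
  have hB : 0 < ∑ y, Real.sqrt (W x y * W x' y) := by
    have := chernoff_sum_pos hW q (1 / 2) x x'
    obtain ⟨y, -, -⟩ := Finset.exists_ne_zero_of_sum_ne_zero this.ne'
    exact Finset.sum_pos (fun y _ => Real.sqrt_pos.2 (mul_pos (hWpos _ _) (hWpos _ _)))
      ⟨y, Finset.mem_univ _⟩
  -- Cauchy–Schwarz: the tilts for (x, x') and (x', x) are reciprocal, so the product of the y-terms
  -- does not depend on s.
  have key := Finset.sum_sq_le_sum_mul_sum_of_sq_le_mul Finset.univ
    (r := fun y => Real.sqrt (W x y * W x' y))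
    (f := fun y => W x y * (Real.exp (q x' y) / Real.exp (q x y)) ^ s)
    (g := fun y => W x' y * (Real.exp (q x y) / Real.exp (q x' y)) ^ s)
    (fun y _ => mul_nonneg (hWpos _ _).le (by positivity))
    (fun y _ => mul_nonneg (hWpos _ _).le (by positivity)) (fun y _ => le_of_eq <| by
      rw [Real.sq_sqrt (mul_nonneg (hWpos _ _).le (hWpos _ _).le), exp_div_exp_rpow,
        exp_div_exp_rpow, mul_mul_mul_comm, ← Real.exp_add]
      have : s * (q x' y - q x y) + s * (q x y - q x' y) = 0 := by ring
      rw [this, Real.exp_zero, mul_one])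
  have := Real.log_le_log (pow_pos hB 2) key
  rw [Real.log_pow, Real.log_mul hZ.ne' hZ'.ne'] at this
  simp only [chernoff, bhattacharyya]
  push_cast at this
  linarith

/-- A bound for a Chernoff distance passes to the Bhattacharyya distance. -/
theorem SatisfiesLagrangeBound.bhattacharyya {R : ℝ} {P : X → ℝ} {W q : X → Y → ℝ}
    (hW : ∀ x, W x ∈ stdSimplex ℝ Y) (hWpos : ∀ x y, 0 < W x y)
    {s ρ E : ℝ} (hρ : 0 ≤ ρ)
    (h : SatisfiesLagrangeBound R P (chernoff W q s) ρ E) :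
    SatisfiesLagrangeBound R P (bhattacharyya W) ρ E := by
  intro Q hQ h1 h2
  set Q' := law Q Prod.swap with hQ'
  have hQ'0 : Q' ∈ stdSimplex ℝ (X × X) := law_mem_stdSimplex hQ _
  have hc : Q ∈ couplings P := ⟨hQ, h1, h2⟩
  have hc' : Q' ∈ couplings P := ⟨hQ'0, by rw [hQ', law_law]; exact h2,
    by rw [hQ', law_law]; exact h1⟩
  -- The symmetrized coupling: its information is no larger by convexity, and its d_s-cost is the
  -- `Q`-average of the symmetrized Chernoff distance.
  set M := (1 / 2 : ℝ) • Q + (1 / 2 : ℝ) • Q' with hM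
  have hMc : M ∈ couplings P := convex_couplings P hc hc' (by norm_num) (by norm_num) (by norm_num)
  have hE := h M hMc.1 hMc.2.1 hMc.2.2
  have hswap : ∀ p, Q' p.swap = Q p := law_of_injective Q Prod.swap_injective
  have hIsymm : logDiv (fun p => Real.log (P p.1 * P p.2)) Q' =
      logDiv (fun p => Real.log (P p.1 * P p.2)) Q := by
    rw [logDiv, logDiv, ← (Equiv.prodComm X X).sum_comp]
    refine Finset.sum_congr rfl fun p _ => ?_
    rw [Equiv.prodComm_apply, hswap, Prod.fst_swap, Prod.snd_swap, mul_comm (P p.2)]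
  have hI : mutualInfo M Prod.fst Prod.snd ≤ mutualInfo Q Prod.fst Prod.snd := by
    rw [mutualInfo_eq_logDiv hMc, mutualInfo_eq_logDiv hc]
    refine ((convexOn_logDiv _).2 hQ hQ'0 (by norm_num) (by norm_num) (by norm_num)).trans_eq ?_
    rw [hIsymm, ← add_smul]
    norm_num
  have hd : additive (chernoff W q s) M ≤ additive (RGV.bhattacharyya W) Q := by
    rw [additive_eq_sum, additive_eq_sum]
    have e : ∑ p, M p * chernoff W q s p.1 p.2 =
        ∑ p, Q p * ((chernoff W q s p.1 p.2 + chernoff W q s p.2 p.1) / 2) := by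
      have := sum_law_mul Q Prod.swap (fun p => chernoff W q s p.1 p.2)
      simp only [Prod.fst_swap, Prod.snd_swap, ← hQ'] at this
      calc _ = (1 / 2) * ∑ p, Q p * chernoff W q s p.1 p.2 +
            (1 / 2) * ∑ p, Q' p * chernoff W q s p.1 p.2 := by
            rw [Finset.mul_sum, Finset.mul_sum, ← Finset.sum_add_distrib]
            exact Finset.sum_congr rfl fun p _ => by
              simp only [hM, Pi.add_apply, Pi.smul_apply, smul_eq_mul]; ring
        _ = _ := by
            rw [this, Finset.mul_sum, Finset.mul_sum, ← Finset.sum_add_distrib]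
            exact Finset.sum_congr rfl fun p _ => by ring
    rw [e]
    refine Finset.sum_le_sum fun p _ => mul_le_mul_of_nonneg_left ?_ (hQ.1 p)
    linarith [chernoff_add_chernoff_le (q := q) hW hWpos s p.1 p.2]
  have := mul_le_mul_of_nonneg_left (sub_le_sub_right hI R) (by linarith : 0 ≤ 1 + ρ)
  linarith

/-! ### The dual objectives at the threshold, and attainment. -/

section Threshold

variable {R : ℝ} {P : X → ℝ} {W q : X → Y → ℝ}

theorem exThreshold_eq (R : ℝ) (P : X → ℝ) (d : X → X → ℝ) (ρ : ℝ) (a : X → ℝ) (δ : ℝ) :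
    exThreshold R P d ρ a δ = exDualObjective R P d ρ a - (1 + ρ) * (2 * δ) := by
  rw [exThreshold, exDualObjective]; ring

theorem rateDualObjective_exThreshold (hP : P ∈ stdSimplex ℝ X) (d : X → X → ℝ) {ρ : ℝ}
    (hρ : 0 ≤ ρ) (a : X → ℝ) (δ : ℝ) :
    rateDualObjective P d (exThreshold R P d ρ a δ) (1 / (1 + ρ)) a - 2 * δ = R := by
  set Δ := exThreshold R P d ρ a δ with hΔ
  have hρ' : 1 + ρ ≠ 0 := by positivity
  have hZ := sum_exp_pos hP d ρ a
  -- Factoring e^{a(x)-φ+Δ/(1+ρ)} out leaves the sum in `exSum`; the P-average of a(x) - φ vanishes.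
  have h1 : ∀ x, Real.log (∑ x', P x' * Real.exp (a x' - ∑ z, P z * a z) *
      Real.exp (-(1 / (1 + ρ)) * (d x x' - Δ))) = (a x - ∑ z, P z * a z + Δ / (1 + ρ)) +
      Real.log (∑ x', P x' * Real.exp (-(d x x') / (1 + ρ)) *
        (Real.exp (a x') / Real.exp (a x))) := by
    intro x
    rw [← Real.log_exp (a x - ∑ z, P z * a z + Δ / (1 + ρ)),
      ← Real.log_mul (Real.exp_ne_zero _) (hZ x).ne', Finset.mul_sum]
    congr 1
    refine Finset.sum_congr rfl fun x' _ => ?_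
    rw [← Real.exp_sub, mul_assoc, mul_assoc, ← Real.exp_add, ← Real.exp_add, mul_left_comm,
      ← Real.exp_add]
    congr 2
    field_simp
    ring
  rw [rateDualObjective]
  simp only [h1]
  simp only [mul_add, Finset.sum_add_distrib, mul_sub, Finset.sum_sub_distrib,
    ← Finset.sum_mul, hP.2]
  change -(_ + exSum P d ρ a) - _ = _
  rw [hΔ, exThreshold]
  field_simp
  ring

/-- At exponent 1 the sum over y moves inside and produces e^{-d_s}; the factor e^{ρd_s/(1+ρ)} turns
it into e^{-d_s/(1+ρ)}. -/
theorem rgvDualObjective_exThreshold (hP : P ∈ stdSimplex ℝ X) (hW : ∀ x, W x ∈ stdSimplex ℝ Y)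
    (s : ℝ) {ρ : ℝ} (hρ : 0 ≤ ρ) (a : X → ℝ) (δ : ℝ) :
    rgvDualObjective R P W q (chernoff W q s) (exThreshold R P (chernoff W q s) ρ a δ) 1
      (ρ / (1 + ρ)) s a = exDualObjective R P (chernoff W q s) ρ a - 2 * δ * ρ := by
  set d := chernoff W q s with hd
  set Δ := exThreshold R P d ρ a δ with hΔ
  have hρ' : 1 + ρ ≠ 0 := by positivity
  have hZ := sum_exp_pos hP d ρ a
  have h1 : ∀ x, Real.log (∑ y, W x y * ((∑ x', P x' * Real.exp (s * q x' y) * Real.exp (a x') *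
      Real.exp (ρ / (1 + ρ) * (d x x' - Δ))) / (Real.exp (s * q x y) * Real.exp (a x))) ^ (1 : ℝ)) =
      -(ρ / (1 + ρ) * Δ) + Real.log (∑ x', P x' * Real.exp (-(d x x') / (1 + ρ)) *
        (Real.exp (a x') / Real.exp (a x))) := by
    intro x
    rw [← Real.log_exp (-(ρ / (1 + ρ) * Δ)),
      ← Real.log_mul (Real.exp_ne_zero _) (hZ x).ne', Finset.mul_sum]
    congr 1
    simp only [Real.rpow_one, Finset.sum_div, Finset.mul_sum]
    rw [Finset.sum_comm]
    refine Finset.sum_congr rfl fun x' _ => ?_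
    have h2 : -(d x x') / (1 + ρ) = -(d x x') + ρ / (1 + ρ) * d x x' := by field_simp; ring
    rw [h2, Real.exp_add, exp_neg_chernoff hW, Finset.sum_mul, Finset.mul_sum, Finset.sum_mul,
      Finset.mul_sum]
    refine Finset.sum_congr rfl fun y _ => ?_
    rw [mul_sub s, mul_sub (ρ / (1 + ρ)), Real.exp_sub, Real.exp_sub, Real.exp_neg]
    field_simp
  rw [rgvDualObjective]
  simp only [h1]
  simp only [mul_add, Finset.sum_add_distrib, ← Finset.sum_mul, hP.2]
  change -(_ + exSum P d ρ a) - _ = _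
  rw [hΔ, exThreshold, exDualObjective]
  field_simp
  ring

theorem SatisfiesLagrangeBound.attains (hW : ∀ x, W x ∈ stdSimplex ℝ Y) {s ρ E E' : ℝ}
    (hs : 0 ≤ s) (hρ : 0 ≤ ρ) (h : SatisfiesLagrangeBound R P (chernoff W q s) ρ E')
    (hE : E < E') : Attains R P W q (chernoff W q s) E := by
  have hpos : 0 < 2 * ρ + 1 := by positivity
  -- The loss 2δρ has to stay below E' - E; the added 1 covers ρ = 0.
  refine ⟨(E' - E) / (2 * ρ + 1), div_pos (sub_pos.2 hE) hpos, fun δ hδ hδ' =>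
    ⟨_, h.rateCondition hρ δ, le_trans ?_ (h.le_rgvExponent hW hs hρ)⟩⟩
  rw [lt_div_iff₀ hpos] at hδ'
  exact EReal.coe_le_coe_iff.2 (by nlinarith)

theorem attains_of_le_rc (hW : ∀ x, W x ∈ stdSimplex ℝ Y) (d : X → X → ℝ) {E : ℝ}
    (hE : (E : EReal) ≤ max (rcExponent R P W (additive q)) (rcDual R P W q)) :
    Attains R P W q d E := by
  obtain ⟨m, hm⟩ := (Set.finite_range fun p : X × X => d p.1 p.2).bddBelow
  refine ⟨1, one_pos, fun δ _ _ => ⟨m - 1, rateCondition_of_lt R P (fun x x' => ?_) δ, hE.trans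
    (max_le (rcExponent_le_rgvExponent R P W _ _ _) (rcDual_le_rgvExponent R P hW q _ _))⟩⟩
  have : m ≤ d x x' := hm ⟨(x, x'), rfl⟩
  linarith

/-- Below the four exponents there is either a random-coding bound or a Lagrange bound. -/
theorem le_rc_or_exists_bound (hP : P ∈ stdSimplex ℝ X) (hW : ∀ x, W x ∈ stdSimplex ℝ Y)
    (hR : 0 < R) {E : ℝ}
    (hE : (E : EReal) < max (max (rcExponent R P W (additive q)) (rcDual R P W q))
      (max (exExponent R P W (additive q)) (exDual R P W q))) :
    (E : EReal) ≤ max (rcExponent R P W (additive q)) (rcDual R P W q) ∨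
      ∃ s ρ E' : ℝ, 0 < s ∧ 0 ≤ ρ ∧ E < E' ∧
        SatisfiesLagrangeBound R P (chernoff W q s) ρ E' := by
  have aux : ∀ s ρ E' : ℝ, 0 ≤ s → 0 ≤ ρ → E < E' →
      SatisfiesLagrangeBound R P (chernoff W q s) ρ E' →
      (E : EReal) ≤ max (rcExponent R P W (additive q)) (rcDual R P W q) ∨
      ∃ s ρ E' : ℝ, 0 < s ∧ 0 ≤ ρ ∧ E < E' ∧
        SatisfiesLagrangeBound R P (chernoff W q s) ρ E' := by
    intro s ρ E' hs hρ hEE' h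
    -- Item 3 asks for s > 0. At s = 0 the level is negative, hence below `rcDual`, which is
    -- nonnegative.
    rcases hs.eq_or_lt with rfl | hs
    · have := lt_zero_of_chernoff_zero hR hP hW hρ h
      refine Or.inl (le_max_of_le_right (le_trans ?_ (zero_le_rcDual R P hW q)))
      exact EReal.coe_nonpos.2 (by linarith)
    · exact Or.inr ⟨s, ρ, E', hs, hρ, hEE', h⟩
  rcases lt_max_iff.1 hE with hE | hE
  · exact Or.inl hE.le
  rcases lt_max_iff.1 hE with hE | hE
  · obtain ⟨E', hE1, hE2⟩ := EReal.lt_iff_exists_real_btwn.1 hE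
    obtain ⟨s, ρ, hs, hρ, h⟩ := exists_satisfiesLagrangeBound hW hE2
    exact aux s ρ E' hs hρ (EReal.coe_lt_coe_iff.1 hE1) h
  · simp only [exDual, lt_iSup_iff] at hE
    obtain ⟨ρ, hρ, s, hs, a, hE⟩ := hE
    exact aux s ρ _ hs hρ (EReal.coe_lt_coe_iff.1 hE)
      (satisfiesLagrangeBound_exDualObjective R hP _ hρ a)

end Threshold

end RGV

end

/-! ### The main theorem. -/

theorem mainTheorem8 {X Y : Type*} [Fintype X] [Fintype Y]
    (P : X → ℝ) (hP : P ∈ stdSimplex ℝ X)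
    (W : X → Y → ℝ) (hW : ∀ x, W x ∈ stdSimplex ℝ Y)
    (q : X → Y → ℝ) (R : ℝ) (hR : 0 < R) :
    -- the random-coding exponent: trivial rate condition, and domination in both forms
    (∀ s : ℝ, 0 < s → ∀ Δ : ℝ,
      ((∀ x x' : X, Δ < RGV.chernoff W q s x x') →
        ∀ δ : ℝ, 0 < δ →
          RGV.RateCondition R P (RGV.additive (RGV.chernoff W q s)) Δ δ) ∧
      max (RGV.rcExponent R P W (RGV.additive q)) (RGV.rcDual R P W q) ≤
        RGV.rgvExponent R P W (RGV.additive q) (RGV.additive (RGV.chernoff W q s)) Δ) ∧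
    -- the expurgated exponent: the choice `ρ = 1` in the dual form and the threshold `Δ`
    (∀ s : ℝ, 0 < s → ∀ ρ' : ℝ, 0 ≤ ρ' → ∀ (a : X → ℝ) (δ : ℝ), 0 < δ → ∀ Δ : ℝ,
      Δ = RGV.exThreshold R P (RGV.chernoff W q s) ρ' a δ →
        RGV.rateDualObjective P (RGV.chernoff W q s) Δ (1 / (1 + ρ')) a - 2 * δ = R ∧
        RGV.rgvDualObjective R P W q (RGV.chernoff W q s) Δ 1 (ρ' / (1 + ρ')) s a =
          RGV.exDualObjective R P (RGV.chernoff W q s) ρ' a - 2 * δ * ρ' ∧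
        RGV.RateCondition R P (RGV.additive (RGV.chernoff W q s)) Δ δ ∧
        ((RGV.exDualObjective R P (RGV.chernoff W q s) ρ' a - 2 * δ * ρ' : ℝ) : EReal) ≤
          RGV.rgvExponent R P W (RGV.additive q) (RGV.additive (RGV.chernoff W q s)) Δ) ∧
    -- both exponents (primal and dual forms) are recovered for suitable `s > 0`
    (∀ E : ℝ,
      (E : EReal) < max (max (RGV.rcExponent R P W (RGV.additive q)) (RGV.rcDual R P W q))
        (max (RGV.exExponent R P W (RGV.additive q)) (RGV.exDual R P W q)) →
      ∃ s : ℝ, 0 < s ∧ RGV.Attains R P W q (RGV.chernoff W q s) E) ∧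
    -- ML decoding: `s = 1/2` gives the Bhattacharyya distance, which recovers both exponents
    ((∀ x y, 0 < W x y) → (∀ x y, q x y = Real.log (W x y)) →
      RGV.chernoff W q (1 / 2) = RGV.bhattacharyya W ∧
      (∀ x x' : X, RGV.bhattacharyya W x x' = RGV.bhattacharyya W x' x) ∧
      ∀ E : ℝ,
        (E : EReal) < max (max (RGV.rcExponent R P W (RGV.additive q)) (RGV.rcDual R P W q))
          (max (RGV.exExponent R P W (RGV.additive q)) (RGV.exDual R P W q)) →
        RGV.Attains R P W q (RGV.bhattacharyya W) E) := by
  refine ⟨fun s _ Δ => ⟨fun h δ _ => RGV.rateCondition_of_lt R P h δ,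
    max_le (RGV.rcExponent_le_rgvExponent R P W _ _ _) (RGV.rcDual_le_rgvExponent R P hW q _ _)⟩,
    ?_, ?_, ?_⟩
  · rintro s hs ρ' hρ' a δ _ Δ rfl
    have h := RGV.satisfiesLagrangeBound_exDualObjective R hP (RGV.chernoff W q s) hρ' a
    refine ⟨RGV.rateDualObjective_exThreshold hP _ hρ' a δ,
      RGV.rgvDualObjective_exThreshold hP hW s hρ' a δ, ?_, ?_⟩
    · rw [RGV.exThreshold_eq]
      exact h.rateCondition hρ' δ
    · rw [RGV.exThreshold_eq]
      exact h.le_rgvExponent hW hs.le hρ'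
  · intro E hE
    rcases RGV.le_rc_or_exists_bound hP hW hR hE with h | ⟨s, ρ, E', hs, hρ, hEE', h⟩
    · exact ⟨1, one_pos, RGV.attains_of_le_rc hW _ h⟩
    · exact ⟨s, hs, h.attains hW hs.le hρ hEE'⟩
  · intro hWpos hq
    refine ⟨RGV.chernoff_half hWpos hq, RGV.bhattacharyya_comm W, fun E hE => ?_⟩
    rcases RGV.le_rc_or_exists_bound hP hW hR hE with h | ⟨s, ρ, E', hs, hρ, hEE', h⟩
    · exact RGV.attains_of_le_rc hW _ h
    · have hB := h.bhattacharyya hW hWpos hρ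
      rw [← RGV.chernoff_half hWpos hq] at hB ⊢
      exact hB.attains hW (by norm_num) hρ hEE'
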